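/- For $N\ge 1$ and $1\le i\le N$ put $i'=N+1-i$. Let $P=\sum_{i,j=1}^N E_{ij}\otimes E_{ji}$, $R(u)=1-P/u$, $G=(\delta_{ij'})_{1\le i,j\le N}$, and $R'(u)=G_1R(u)G_1$ with $G_1=G\otimes 1$. The extended twisted Yangian $\mathscr X_N$ of quasi-split type AIII is the unital associative $\mathbb C$-algebra generated by $s_{ij}^{(r)}$ ($1\le i,j\le N$, $r\ge 1$), subject to the relations obtained by comparing coefficients in $$R(u-v)\,S_1(u)\,R'(u+v)\,S_2(v)=S_2(v)\,R'(u+v)\,S_1(u)\,R(u-v),$$ where $S(u)=(s_{ij}(u))_{i,j}$, $s_{ij}(u)=\delta_{ij}+\sum_{r\ge 1}s_{ij}^{(r)}u^{-r}$, $S_1(u)=S(u)\otimes 1$, $S_2(v)=1\otimes S(v)$. For $m\ge 0$ and $m+1\le i,j\le N$ consider the boxed quasideterminant $$Q^{(m)}_{ij}(u)=\begin{vmatrix} s_{11}(u)&\cdots&s_{1m}(u)&s_{1j}(u)\\ \vdots&&\vdots&\vdots\\ s_{m1}(u)&\cdots&s_{mm}(u)&s_{mj}(u)\\ s_{i1}(u)&\cdots&s_{im}(u)&\boxed{s_{ij}(u)}\end{vmatrix}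 = s_{ij}(u)-\sum_{k,l=1}^m s_{ik}(u)\,\bigl(A(u)^{-1}\bigr)_{kl}\,s_{lj}(u),$$ where $A(u)=(s_{kl}(u))_{1\le k,l\le m}$, a matrix over $\mathscr X_N[[u^{-1}]]$. (1) Let $m\ge 0$ and $N-2m\ge 1$. Then $A(u)$ is invertible over $\mathscr X_N[[u^{-1}]]$, and there is a unique homomorphism of unital $\mathbb C$-algebras $\psi_m:\mathscr X_{N-2m}\to\mathscr X_N$ with $\psi_m(s_{ij}(u))=Q^{(m)}_{m+i,\,m+j}(u)$ for all $1\le i,j\le N-2m$ (applied coefficientwise). (2) Such shift homomorphisms exist only between ranks of the same parity: if $M\ge 2$, $m\ge 0$, $m+M\le N$, and there is a homomorphism of unital $\mathbb C$-algebras $\mathscr X_M\to\mathscr X_N$ with $s_{ij}(u)\mapsto Q^{(m)}_{m+i,\,m+j}(u)$ for all $1\le i,j\le M$, then $M=N-2m$; in particular $M\equiv N \pmod 2$. -/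

import Mathlib

open scoped Kronecker

namespace TwistedYangian

noncomputable section

/-- The matrix `S(u) = (s_{ij}(u))` attached to a family `g i j r`, which stands for the
coefficients `s_{ij}^{(r+1)}`. A power series in `X` is a series in `u⁻¹`, so that
`s_{ij}(u) = δ_{ij} + ∑_{r ≥ 1} s_{ij}^{(r)} u^{-r}`. -/
def serMatrix {A : Type*} [Ring A] {N : ℕ} (g : Fin N → Fin N → ℕ → A) :
    Matrix (Fin N) (Fin N) (PowerSeries A) := fun i j =>
  PowerSeries.mk fun r =>
    match r with
    | 0 => if i = j then 1 else 0
    | r + 1 => g i j r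

/-- A series in one variable, viewed as a series in the variable number `a` out of two.
The variables `X 0` and `X 1` stand for `u⁻¹` and `v⁻¹`. -/
def inVar {A : Type*} [Ring A] (a : Fin 2) (f : PowerSeries A) : MvPowerSeries (Fin 2) A :=
  fun d => if d = Finsupp.single a (d a) then PowerSeries.coeff (d a) f else 0

/-- The flip `P = ∑ E_{ij} ⊗ E_{ji}`. -/
def swapMat (N : ℕ) (W : Type*) [Ring W] : Matrix (Fin N × Fin N) (Fin N × Fin N) W :=
  ∑ i, ∑ j, Matrix.single i j 1 ⊗ₖ Matrix.single j i 1

/-- The matrix `G = (δ_{i j'})`, where `i' = N + 1 - i`. -/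
def antiDiag (N : ℕ) (W : Type*) [Ring W] : Matrix (Fin N) (Fin N) W :=
  fun i j => if i = Fin.rev j then 1 else 0

/-- `u⁻¹ v⁻¹ (u - v) R(u - v) = (v⁻¹ - u⁻¹) 1 - u⁻¹ v⁻¹ P`, for the Yang matrix
`R(u) = 1 - P / u`. -/
def rMat (N : ℕ) (A : Type*) [Ring A] :
    Matrix (Fin N × Fin N) (Fin N × Fin N) (MvPowerSeries (Fin 2) A) :=
  (MvPowerSeries.X 1 - MvPowerSeries.X 0 : MvPowerSeries (Fin 2) A) • 1 -
    (MvPowerSeries.X 0 * MvPowerSeries.X 1 : MvPowerSeries (Fin 2) A) • swapMat N _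

/-- `u⁻¹ v⁻¹ (u + v) R'(u + v)`, where `R'(u) = G₁ R(u) G₁`. -/
def rMat' (N : ℕ) (A : Type*) [Ring A] :
    Matrix (Fin N × Fin N) (Fin N × Fin N) (MvPowerSeries (Fin 2) A) :=
  (antiDiag N _ ⊗ₖ 1) *
    ((MvPowerSeries.X 1 + MvPowerSeries.X 0 : MvPowerSeries (Fin 2) A) • 1 -
      (MvPowerSeries.X 0 * MvPowerSeries.X 1 : MvPowerSeries (Fin 2) A) • swapMat N _) *
    (antiDiag N _ ⊗ₖ 1)

/-- `S₁(u) = S(u) ⊗ 1`. -/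
def leg₁ {A : Type*} [Ring A] {N : ℕ} (S : Matrix (Fin N) (Fin N) (PowerSeries A)) :
    Matrix (Fin N × Fin N) (Fin N × Fin N) (MvPowerSeries (Fin 2) A) :=
  S.map (inVar 0) ⊗ₖ 1

/-- `S₂(v) = 1 ⊗ S(v)`. -/
def leg₂ {A : Type*} [Ring A] {N : ℕ} (S : Matrix (Fin N) (Fin N) (PowerSeries A)) :
    Matrix (Fin N × Fin N) (Fin N × Fin N) (MvPowerSeries (Fin 2) A) :=
  1 ⊗ₖ S.map (inVar 1)

/-- `R(u-v) S₁(u) R'(u+v) S₂(v)`, multiplied by `u⁻² v⁻² (u² - v²)`. -/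
def quatLHS {A : Type*} [Ring A] {N : ℕ} (S : Matrix (Fin N) (Fin N) (PowerSeries A)) :
    Matrix (Fin N × Fin N) (Fin N × Fin N) (MvPowerSeries (Fin 2) A) :=
  rMat N A * leg₁ S * rMat' N A * leg₂ S

/-- `S₂(v) R'(u+v) S₁(u) R(u-v)`, multiplied by `u⁻² v⁻² (u² - v²)`. -/
def quatRHS {A : Type*} [Ring A] {N : ℕ} (S : Matrix (Fin N) (Fin N) (PowerSeries A)) :
    Matrix (Fin N × Fin N) (Fin N × Fin N) (MvPowerSeries (Fin 2) A) :=
  leg₂ S * rMat' N A * leg₁ S * rMat N A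

/-- The free algebra on the symbols `s_{ij}^{(r)}`, `r ≥ 1`; the index `(i, j, r)` stands for
`s_{ij}^{(r+1)}`. -/
abbrev FreeGen (N : ℕ) : Type := FreeAlgebra ℂ (Fin N × Fin N × ℕ)

/-- The matrix `S(u)` over the free algebra. -/
def freeS (N : ℕ) : Matrix (Fin N) (Fin N) (PowerSeries (FreeGen N)) :=
  serMatrix fun i j r => FreeAlgebra.ι ℂ (i, j, r)

/-- The quaternary relations
`R(u-v) S₁(u) R'(u+v) S₂(v) = S₂(v) R'(u+v) S₁(u) R(u-v)`, coefficient by coefficient.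
Both sides carry the same central factor `u⁻² v⁻² (u² - v²) = v⁻² - u⁻²`, which is not a zero
divisor and clears the denominators. -/
inductive QuaternaryRel (N : ℕ) : FreeGen N → FreeGen N → Prop
  | quaternary (p q : Fin N × Fin N) (d : Fin 2 →₀ ℕ) :
      QuaternaryRel N
        (MvPowerSeries.coeff d (quatLHS (freeS N) p q))
        (MvPowerSeries.coeff d (quatRHS (freeS N) p q))

/-- The extended twisted Yangian `X_N` of quasi-split type AIII. -/
abbrev ExtTwistedYangian (N : ℕ) : Type := RingQuot (QuaternaryRel N)

/-- The matrix `S(u) = (s_{ij}(u))` over `X_N`. -/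
def S (N : ℕ) : Matrix (Fin N) (Fin N) (PowerSeries (ExtTwistedYangian N)) :=
  serMatrix fun i j r =>
    RingQuot.mkAlgHom ℂ (QuaternaryRel N) (FreeAlgebra.ι ℂ (i, j, r))

/-- The matrix obtained from a square matrix by deleting the last row and column. -/
def leadingMinor {R : Type*} {m : ℕ} (Z : Matrix (Fin (m + 1)) (Fin (m + 1)) R) :
    Matrix (Fin m) (Fin m) R :=
  Z.submatrix Fin.castSucc Fin.castSucc

/-- The quasideterminant of a square matrix over a noncommutative ring whose boxed entry is the
lower right one: `d - c A⁻¹ b` for the matrix with blocks `A`, `b`, `c`, `d`, where `A` is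
invertible. It is the inverse of the lower right entry of the inverse matrix when these
inverses exist. -/
def quasidet {R : Type*} [Ring R] {m : ℕ} (Z : Matrix (Fin (m + 1)) (Fin (m + 1)) R) : R :=
  Z (Fin.last m) (Fin.last m) -
    ∑ k : Fin m, ∑ l : Fin m,
      Z (Fin.last m) k.castSucc * Ring.inverse (leadingMinor Z) k l * Z l.castSucc (Fin.last m)

/-- The index `m + i` in `{1, …, N}`, for `i` in `{1, …, M}`. -/
def shiftIdx {N M m : ℕ} (h : m + M ≤ N) (i : Fin M) : Fin N :=
  ⟨m + i, by omega⟩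

/-- The list of indices `1, …, m, m + i`. -/
def borderIdx {N M m : ℕ} (h : m + M ≤ N) (i : Fin M) : Fin (m + 1) → Fin N :=
  Fin.snoc (α := fun _ => Fin N) (fun k : Fin m => Fin.castLE (by omega) k) (shiftIdx h i)

/-- The block of `S(u)` over `X_N` with rows `1, …, m, m + i` and columns `1, …, m, m + j`. -/
def borderBlock {N M m : ℕ} (h : m + M ≤ N) (i j : Fin M) :
    Matrix (Fin (m + 1)) (Fin (m + 1)) (PowerSeries (ExtTwistedYangian N)) :=
  (S N).submatrix (borderIdx h i) (borderIdx h j)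

/-- `φ` is the shift by `m`: applied to the coefficients of `s_{ij}(u)`, it gives the
quasideterminant of the block on rows `1, …, m, m + i` and columns `1, …, m, m + j`, with the
entry `s_{m+i, m+j}(u)` boxed. -/
def IsShiftHom {N M m : ℕ} (h : m + M ≤ N)
    (φ : ExtTwistedYangian M →ₐ[ℂ] ExtTwistedYangian N) : Prop :=
  ∀ i j : Fin M,
    PowerSeries.map (φ : ExtTwistedYangian M →+* ExtTwistedYangian N) (S M i j) =
      quasidet (borderBlock h i j)

/-- The rows `m + 1, …, m + (N - 2m)` lie in `{1, …, N}`. -/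
theorem shift_le {N m : ℕ} (h : 2 * m + 1 ≤ N) : m + (N - 2 * m) ≤ N := by omega

end

end TwistedYangian

/-!
With denominators cleared, the defining relation is a reflection equation
`R S₁ R' S₂ = S₂ R' S₁ R`, in which `R' = (x + y) - x y G₁ G₂ P`, `x = u⁻¹` and `y = v⁻¹`.

For the existence of the shift let `e₁`, `e₀`, `e₂` be the diagonal idempotents of the first `m`,
the middle `N - 2 m` and the last `m` indices. The quasideterminants `Q^{(m)}` of the middle indices
are the entries of the Schur complement `c = e₀ S e₀ - e₀ S α S e₀`, where `α` inverts the block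
`e₁ S e₁`; both inverses needed exist because `S` has constant coefficient `1`. The claim is that
`c` satisfies the reflection equation on the middle indices. Since `G` interchanges `e₁` and `e₂`
and commutes with `e₀`, the row operation `f = e₀ - e₀ S α`, for which `f S (e₀ + e₁) = c`,
satisfies `f S(u) G S(v) (e₀ - α(v) S(v) e₀) = c(u) G c(v)` (`LegFrame.rowOp_product`). From this
identity one builds a `φ` such that `φ S₁ R' S₂`, on the columns with indices in `e₀ + e₁`, equals
`(x + y) c₁ R' c₂` (`LegFrame.exists_left_elim`); the mirror statement is the same one over the
opposite ring with the two legs interchanged (`LegFrame.exists_right_elim`). Multiplying the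
relation by both factors and using that `R` commutes with the idempotents, one gets the relation for
`c` multiplied by `(x + y)²`, which is not a zero divisor (`LegFrame.schur_reflection`,
`quat_schur`). The universal property of the algebra then gives the homomorphism; it is unique
because the coefficients of `S(u)` generate. This argument is symmetric under `i ↦ N + 1 - i`, which is
why `m` indices have to be dropped at either end.

For the converse, the entry `((N, N), (1, 1))` of the relation of rank `N` shows that `s_{11}^{(1)}`
and `s_{NN}^{(1)}` coincide (`coeff_one_rev_eq`). A shift from rank `M` thus makes
`s_{aa}^{(1)} = s_{bb}^{(1)}` in rank `N` for `a = m + 1` and `b = m + M`. The algebra of rank `N`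
acts on `ℂ^N` by `S(u) ↦ T(u) G T(u) G`, where `T(u) = 1 - u⁻¹ P` is the Yang matrix
(`quatLHS_vectorS`), and there `s_{aa}^{(1)}` acts by `-(E_{aa} + E_{a'a'})`. As `a ≠ b`, the
equality forces `b = a'`, that is `N = M + 2 m`.
-/

namespace TwistedYangian

noncomputable section

/-! ### Schur complements -/

section Schur

variable {K : Type*} [Ring K]

/-- The Schur complement `e₀ s e₀ - e₀ s α s e₀`, where `e₀` is an idempotent and `α` is meant to
invert a complementary corner of `s`. -/
def schur (e₀ s α : K) : K := e₀ * s * e₀ - e₀ * s * α * s * e₀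

/-- For idempotents `e₀` and `e₁`, the element `α` is an inverse of `e₁ s e₁` in the corner ring
`e₁ K e₁`, and `κ` is an inverse of the Schur complement `schur e₀ s α` in `e₀ K e₀`. -/
structure Pivot (e₀ e₁ s α κ : K) : Prop where
  e₁_mul : e₁ * α = α
  mul_e₁ : α * e₁ = α
  right_inv : e₁ * s * α = e₁
  left_inv : α * s * e₁ = e₁
  e₀_mul : e₀ * κ = κ
  mul_e₀ : κ * e₀ = κ
  schur_mul : schur e₀ s α * κ = e₀
  mul_schur : κ * schur e₀ s α = e₀

theorem schur_op (e₀ s α : K) :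
    schur (MulOpposite.op e₀) (MulOpposite.op s) (MulOpposite.op α) =
      MulOpposite.op (schur e₀ s α) := by
  simp [schur, mul_assoc]

theorem Pivot.op {e₀ e₁ s α κ : K} (h : Pivot e₀ e₁ s α κ) :
    Pivot (MulOpposite.op e₀) (MulOpposite.op e₁) (MulOpposite.op s) (MulOpposite.op α)
      (MulOpposite.op κ) := by
  refine ⟨?_, ?_, ?_, ?_, ?_, ?_, ?_, ?_⟩ <;> (try rw [schur_op]) <;>
    simp only [← MulOpposite.op_mul, ← mul_assoc, h.e₁_mul, h.mul_e₁, h.right_inv, h.left_inv,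
      h.e₀_mul, h.mul_e₀, h.schur_mul, h.mul_schur]

end Schur

/-! ### Frames for the reflection equation -/

/-- The data around a reflection equation, in abstract form: two homomorphisms `l₁`, `l₂` from `K`
to `L` (for `K` the ring of `N × N` matrices, the two legs of the tensor square), a flip `p` that
interchanges them, central elements `z`, `w`, and in `K` an element `g` and orthogonal idempotents
`e₀`, `e₁`. The element `g` commutes with `e₀` and interchanges `e₁` with `1 - e₀ - e₁`. The
images of `l₁` and `l₂` need not commute, because the matrix entries need not, but `g`, `e₀` and
`e₁` on either leg commute with the whole other leg. -/
structure LegFrame (K L : Type*) [Ring K] [Ring L] where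
  l₁ : K →+* L
  l₂ : K →+* L
  p : L
  z : L
  w : L
  g : K
  e₀ : K
  e₁ : K
  p_l₁ : ∀ k, p * l₁ k = l₂ k * p
  p_l₂ : ∀ k, p * l₂ k = l₁ k * p
  z_comm : ∀ x, Commute z x
  w_comm : ∀ x, Commute w x
  g_comm : ∀ k, Commute (l₁ g) (l₂ k)
  g_comm' : ∀ k, Commute (l₂ g) (l₁ k)
  e₀_comm : ∀ k, Commute (l₁ e₀) (l₂ k)
  e₀_comm' : ∀ k, Commute (l₂ e₀) (l₁ k)
  e₁_comm : ∀ k, Commute (l₁ e₁) (l₂ k)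
  e₁_comm' : ∀ k, Commute (l₂ e₁) (l₁ k)
  e₀_e₀ : e₀ * e₀ = e₀
  e₁_e₁ : e₁ * e₁ = e₁
  e₀_e₁ : e₀ * e₁ = 0
  e₁_e₀ : e₁ * e₀ = 0
  g_e₀ : g * e₀ = e₀ * g
  g_e₁ : g * e₁ = (1 - e₀ - e₁) * g

namespace LegFrame

variable {K L : Type*} [Ring K] [Ring L] (F : LegFrame K L)

/-- The element `z - w g₁ g₂ p`, the abstract form of `G₁ (z - w P) G₁`. -/
def refl : L := F.z - F.w * (F.l₁ F.g * F.l₂ F.g * F.p)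

/-- The same frame with the two legs interchanged. -/
def swap : LegFrame K L :=
  { F with
    l₁ := F.l₂, l₂ := F.l₁, p_l₁ := F.p_l₂, p_l₂ := F.p_l₁
    g_comm := F.g_comm', g_comm' := F.g_comm, e₀_comm := F.e₀_comm', e₀_comm' := F.e₀_comm
    e₁_comm := F.e₁_comm', e₁_comm' := F.e₁_comm }

theorem e₁_g : F.e₁ * F.g = F.g * (1 - F.e₀ - F.e₁) := by
  have h := F.g_e₁
  simp only [mul_sub, sub_mul, one_mul, mul_one, F.g_e₀] at h ⊢
  rw [h]; abel

theorem swap_refl : F.swap.refl = F.refl := by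
  simp only [refl, swap, (F.g_comm F.g).eq]

open MulOpposite in
/-- The frame over the opposite rings. The legs are interchanged, so that a product
`l₁ s * refl * l₂ t` goes to a product of the same shape. -/
def op : LegFrame Kᵐᵒᵖ Lᵐᵒᵖ where
  l₁ := RingHom.op F.l₂
  l₂ := RingHom.op F.l₁
  p := MulOpposite.op F.p
  z := MulOpposite.op F.z
  w := MulOpposite.op F.w
  g := MulOpposite.op F.g
  e₀ := MulOpposite.op F.e₀
  e₁ := MulOpposite.op F.e₁
  p_l₁ k := unop_injective (by simpa using (F.p_l₁ k.unop).symm)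
  p_l₂ k := unop_injective (by simpa using (F.p_l₂ k.unop).symm)
  z_comm x := unop_injective (F.z_comm x.unop).eq.symm
  w_comm x := unop_injective (F.w_comm x.unop).eq.symm
  g_comm k := unop_injective (F.g_comm' k.unop).eq.symm
  g_comm' k := unop_injective (F.g_comm k.unop).eq.symm
  e₀_comm k := unop_injective (F.e₀_comm' k.unop).eq.symm
  e₀_comm' k := unop_injective (F.e₀_comm k.unop).eq.symm
  e₁_comm k := unop_injective (F.e₁_comm' k.unop).eq.symm
  e₁_comm' k := unop_injective (F.e₁_comm k.unop).eq.symm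
  e₀_e₀ := unop_injective F.e₀_e₀
  e₁_e₁ := unop_injective F.e₁_e₁
  e₀_e₁ := unop_injective F.e₁_e₀
  e₁_e₀ := unop_injective F.e₀_e₁
  g_e₀ := unop_injective F.g_e₀.symm
  g_e₁ := unop_injective F.e₁_g

theorem refl_op : F.op.refl = MulOpposite.op F.refl := by
  apply MulOpposite.unop_injective
  have h : F.p * (F.l₁ F.g * F.l₂ F.g) = F.l₁ F.g * F.l₂ F.g * F.p := by
    rw [← mul_assoc, F.p_l₁, mul_assoc, F.p_l₂, ← mul_assoc, (F.g_comm' F.g).eq]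
  simp [refl, op, h, (F.w_comm _).eq]

/-- The idempotent `e₀ + e₁` of the indices that enter the Schur complement. -/
def e : K := F.e₀ + F.e₁

theorem e_comm (k : K) : Commute (F.l₁ F.e) (F.l₂ k) := by
  rw [e, map_add]; exact (F.e₀_comm k).add_left (F.e₁_comm k)

theorem e_comm' (k : K) : Commute (F.l₂ F.e) (F.l₁ k) := by
  rw [e, map_add]; exact (F.e₀_comm' k).add_left (F.e₁_comm' k)

theorem e₀_e : F.e₀ * F.e = F.e₀ := by simp [e, mul_add, F.e₀_e₀, F.e₀_e₁]

theorem e₁_e : F.e₁ * F.e = F.e₁ := by simp [e, mul_add, F.e₁_e₁, F.e₁_e₀]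

theorem g_one_sub_e : F.g * (1 - F.e) = F.e₁ * F.g := by
  rw [F.e₁_g, e, sub_sub]

theorem e₁_g_e : F.e₁ * F.g * F.e = 0 := by
  rw [← g_one_sub_e, mul_assoc, sub_mul, one_mul]
  simp [e, add_mul, mul_add, F.e₀_e₀, F.e₁_e₀, F.e₀_e₁, F.e₁_e₁]

/-- The two instances of `e` cut `g` down to its middle block, because `g` moves `e₁` to the indices
outside `e`. -/
theorem e_g_e : F.e * F.g * F.e = F.e₀ * F.g := by
  have h : F.e₀ * F.g * F.e = F.e₀ * F.g := by
    rw [← F.g_e₀, mul_assoc, F.e₀_e]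
  calc F.e * F.g * F.e = F.e₀ * F.g * F.e + F.e₁ * F.g * F.e := by
        rw [← add_mul, ← add_mul, ← e]
    _ = F.e₀ * F.g := by rw [F.e₁_g_e, h, add_zero]

/-! ### Row operations and elimination -/

variable {s t α β κ : K}

/-- The row operation `e₀ - e₀ s α`, which clears the block `e₀ s e₁` of `s`. -/
def rowOp (s α : K) : K := F.e₀ - F.e₀ * s * α

variable {F}

section
variable (hs : Pivot F.e₀ F.e₁ s α κ)
include hs

theorem rowOp_e₀ : F.rowOp s α * F.e₀ = F.e₀ := by
  have : α * F.e₀ = 0 := by rw [← hs.mul_e₁, mul_assoc, F.e₁_e₀, mul_zero]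
  rw [rowOp, sub_mul, F.e₀_e₀, mul_assoc, this, mul_zero, sub_zero]

theorem rowOp_e : F.rowOp s α * F.e = F.rowOp s α := by
  have : α * F.e = α := by rw [← hs.mul_e₁, mul_assoc, F.e₁_e]
  rw [rowOp, sub_mul, F.e₀_e, mul_assoc, this]

theorem rowOp_s_e₁ : F.rowOp s α * s * F.e₁ = 0 := by
  have : F.e₀ * s * α * s * F.e₁ = F.e₀ * s * F.e₁ := by
    rw [mul_assoc (F.e₀ * s), mul_assoc (F.e₀ * s), hs.left_inv]
  rw [rowOp, sub_mul, sub_mul, this, sub_self]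

omit hs in
theorem rowOp_s_e₀ : F.rowOp s α * s * F.e₀ = schur F.e₀ s α := by
  rw [rowOp, sub_mul, sub_mul, schur]

theorem rowOp_s_e : F.rowOp s α * s * F.e = schur F.e₀ s α := by
  rw [e, mul_add, rowOp_s_e₁ hs, rowOp_s_e₀, add_zero]

theorem e_s_col : F.e * s * (F.e₀ - α * s * F.e₀) = schur F.e₀ s α := by
  have h : F.e₁ * s * (F.e₀ - α * s * F.e₀) = 0 := by
    rw [mul_sub, ← mul_assoc, ← mul_assoc, hs.right_inv, sub_self]
  rw [e, add_mul, add_mul, h, add_zero, schur]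
  noncomm_ring

end

theorem e₀_schur : F.e₀ * schur F.e₀ s α = schur F.e₀ s α := by
  simp only [schur, mul_sub, ← mul_assoc, F.e₀_e₀]

theorem schur_e₀ : schur F.e₀ s α * F.e₀ = schur F.e₀ s α := by
  simp only [schur, sub_mul, mul_assoc, F.e₀_e₀]

/-- After the row operation on `s`, the product of `s`, `g` and `t` equals its analogue for the
Schur complements up to a multiple of `β t e`. Modulo that multiple `t e` may be replaced by
`t (e₀ - β t e₀)`, whose rows in `e` form the Schur complement of `t`; its other rows are moved into
`e₁` by `g` and are killed by `rowOp s α * s`. -/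
theorem rowOp_product (hs : Pivot F.e₀ F.e₁ s α κ) {κ' : K} (ht : Pivot F.e₀ F.e₁ t β κ') :
    F.rowOp s α * s * F.g * t * F.e =
      schur F.e₀ s α * F.g * schur F.e₀ t β +
        F.rowOp s α * s * F.g * t * β * t * F.e := by
  have h₁ : β * t * F.e = F.e₁ + β * t * F.e₀ := by
    rw [e, mul_add, ht.left_inv, add_comm]
  have h₂ : F.rowOp s α * s * F.g * (1 - F.e) = 0 := by
    rw [mul_assoc, g_one_sub_e, ← mul_assoc, rowOp_s_e₁ hs, zero_mul]
  have h₃ : F.rowOp s α * s * F.g * schur F.e₀ t β =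
      schur F.e₀ s α * F.g * schur F.e₀ t β := by
    conv_lhs => rw [← F.e₀_schur, ← mul_assoc, mul_assoc _ F.g, F.g_e₀, ← mul_assoc, rowOp_s_e₀]
  calc F.rowOp s α * s * F.g * t * F.e
      = F.rowOp s α * s * F.g * (F.e * t * (F.e₀ - β * t * F.e₀)) +
        F.rowOp s α * s * F.g * (1 - F.e) * t * (F.e₀ - β * t * F.e₀) +
        F.rowOp s α * s * F.g * t * (F.e₁ + β * t * F.e₀) := by
          rw [e]; noncomm_ring
    _ = _ := by
          rw [e_s_col ht, h₂, h₃, ← h₁]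
          simp only [zero_mul, add_zero, mul_assoc]

/-- Multiplication of a reflection product on the left by the first leg, with the flip `p` moved to
the right. -/
theorem l₁_mul_reflection (F : LegFrame K L) (a s t : K) :
    F.l₁ a * (F.l₁ s * F.refl * F.l₂ t) * (F.l₁ F.e * F.l₂ F.e) =
      F.z * (F.l₁ (a * s * F.e) * F.l₂ (t * F.e)) -
        F.w * (F.l₁ (a * s * F.g * t * F.e) * F.l₂ (F.g * F.e) * F.p) := by
  have hz₁ (x y : L) : x * (F.z * y) = F.z * (x * y) := (F.z_comm x).symm.left_comm y
  have hw₁ (x y : L) : x * (F.w * y) = F.w * (x * y) := (F.w_comm x).symm.left_comm y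
  have hp₁ (k : K) (y : L) : F.p * (F.l₁ k * y) = F.l₂ k * (F.p * y) := by
    rw [← mul_assoc, F.p_l₁, mul_assoc]
  have hp₂ (k : K) (y : L) : F.p * (F.l₂ k * y) = F.l₁ k * (F.p * y) := by
    rw [← mul_assoc, F.p_l₂, mul_assoc]
  have he (k : K) (y : L) : F.l₂ k * (F.l₁ F.e * y) = F.l₁ F.e * (F.l₂ k * y) :=
    (F.e_comm k).symm.left_comm y
  have he' (k : K) (y : L) : F.l₂ F.e * (F.l₁ k * y) = F.l₁ k * (F.l₂ F.e * y) :=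
    (F.e_comm' k).left_comm y
  have hg' (k : K) (y : L) : F.l₂ F.g * (F.l₁ k * y) = F.l₁ k * (F.l₂ F.g * y) :=
    (F.g_comm' k).left_comm y
  have h₁ : F.l₁ a * (F.l₁ s * F.z * F.l₂ t) * (F.l₁ F.e * F.l₂ F.e) =
      F.z * (F.l₁ (a * s * F.e) * F.l₂ (t * F.e)) := by
    simp only [mul_assoc, hz₁, map_mul, he]
  have h₂ : F.l₁ a * (F.l₁ s * (F.w * (F.l₁ F.g * F.l₂ F.g * F.p)) * F.l₂ t) *
      (F.l₁ F.e * F.l₂ F.e) =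
        F.w * (F.l₁ (a * s * F.g * t * F.e) * F.l₂ (F.g * F.e) * F.p) := by
    have hpe : F.p * F.l₂ F.e = F.l₁ F.e * F.p := F.p_l₂ _
    simp only [mul_assoc, hw₁, map_mul, hp₂, hp₁, he, he', hg', hpe]
  rw [← h₁, ← h₂, refl]
  simp only [mul_sub, sub_mul]

/-- Left multiplication by a suitable `φ` reduces the reflection product of `s`, `t`, restricted to
the columns in `e ⊗ e`, to that of the Schur complements. The second of the two summands of `φ`
produces a factor `z`, and the first one is multiplied by `z` so that their remainders cancel. -/
theorem exists_left_elim (hs : Pivot F.e₀ F.e₁ s α κ) {κ' : K} (ht : Pivot F.e₀ F.e₁ t β κ') :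
    ∃ φ : L, φ * (F.l₁ F.e * F.l₂ F.e) = φ ∧
      φ * (F.l₁ F.e₀ * F.l₂ F.e₀) = F.z * (F.l₁ F.e₀ * F.l₂ F.e₀) ∧
      φ * (F.l₁ s * F.refl * F.l₂ t) * (F.l₁ F.e * F.l₂ F.e) =
        F.z * (F.l₁ F.e₀ * F.l₂ F.e₀ * (F.l₁ (schur F.e₀ s α) * F.refl * F.l₂ (schur F.e₀ t β)) *
          (F.l₁ F.e₀ * F.l₂ F.e₀)) := by
  have hz (x y : L) : x * (F.z * y) = F.z * (x * y) := (F.z_comm x).symm.left_comm y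
  have hw (x y : L) : x * (F.w * y) = F.w * (x * y) := (F.w_comm x).symm.left_comm y
  set f := F.rowOp s α with hf
  set f' := F.rowOp t β
  set c := schur F.e₀ s α
  set c' := schur F.e₀ t β
  obtain ⟨q, hq⟩ : ∃ q, q = f * s * F.g * t := ⟨_, rfl⟩
  have hqe : q * F.e = c * F.g * c' + q * β * t * F.e := hq ▸ rowOp_product hs ht
  have hge : F.e₀ * F.g * F.e₀ = F.e₀ * F.g := by rw [mul_assoc, F.g_e₀, ← mul_assoc, F.e₀_e₀]
  have hκf : κ * f * s * F.e = F.e₀ := by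
    rw [mul_assoc κ, mul_assoc κ, rowOp_s_e hs, hs.mul_schur]
  have hf'e : f' * F.e = f' := rowOp_e ht
  have hf'e₀ : f' * F.e₀ = F.e₀ := rowOp_e₀ ht
  have hce₀ : c * F.e₀ = c := schur_e₀
  have stepκ : F.l₁ (κ * f) * (F.l₁ s * F.refl * F.l₂ t) * (F.l₁ F.e * F.l₂ F.e) =
      F.z * (F.l₁ F.e₀ * F.l₂ (t * F.e)) -
        F.w * (F.l₁ (κ * q * F.e) * F.l₂ (F.g * F.e) * F.p) := by
    rw [l₁_mul_reflection, hκf]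
    simp only [hq, mul_assoc]
  have hfge (k : K) : F.l₂ f' * (F.l₁ k * F.l₂ (F.g * F.e)) = F.l₁ k * F.l₂ (F.e₀ * F.g) := by
    rw [← hf'e, map_mul, mul_assoc, (F.e_comm' k).left_comm, ← map_mul, ← mul_assoc F.e, F.e_g_e,
      map_mul F.l₂ F.e₀, ← (F.e₀_comm' k).left_comm, ← mul_assoc, ← map_mul, hf'e₀,
      (F.e₀_comm' k).left_comm]
  have stepA : F.l₁ c * F.l₂ f' * F.l₁ (κ * f) * (F.l₁ s * F.refl * F.l₂ t) *
      (F.l₁ F.e * F.l₂ F.e) =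
      F.z * (F.l₁ c * F.l₂ c') - F.w * (F.l₁ (q * F.e) * F.l₂ (F.e₀ * F.g) * F.p) := by
    have h₁ : F.l₁ c * (F.l₂ f' * (F.l₁ F.e₀ * F.l₂ (t * F.e))) = F.l₁ c * F.l₂ c' := by
      rw [← (F.e₀_comm f').left_comm, ← map_mul F.l₂, ← mul_assoc f', rowOp_s_e ht, ← mul_assoc,
        ← map_mul, hce₀]
    have h₂ : F.l₁ c * (F.l₂ f' * (F.l₁ (κ * q * F.e) * F.l₂ (F.g * F.e))) =
        F.l₁ (q * F.e) * F.l₂ (F.e₀ * F.g) := by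
      rw [hfge, ← mul_assoc, ← map_mul]
      have : c * (κ * q * F.e) = q * F.e := by
        rw [mul_assoc κ, ← mul_assoc c, hs.schur_mul, hq, hf, rowOp]
        simp only [← mul_assoc, sub_mul, mul_sub, F.e₀_e₀]
      rw [this]
    calc _ = F.l₁ c * F.l₂ f' * (F.l₁ (κ * f) * (F.l₁ s * F.refl * F.l₂ t) *
      (F.l₁ F.e * F.l₂ F.e)) := by simp only [mul_assoc]
      _ = _ := by
        rw [stepκ, mul_sub, hz, hw, mul_assoc, h₁, ← mul_assoc _ _ F.p, mul_assoc (F.l₁ c), h₂]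
  have stepB : F.l₁ (q * β) * F.l₂ (F.e₀ * F.g) * F.p * F.l₁ (κ * f) * F.l₂ F.e₁ *
      (F.l₁ s * F.refl * F.l₂ t) * (F.l₁ F.e * F.l₂ F.e) =
      F.z * (F.l₁ (q * β * t * F.e) * F.l₂ (F.e₀ * F.g) * F.p) := by
    have h₁ : F.l₂ F.e₁ * (F.l₁ (κ * q * F.e) * F.l₂ (F.g * F.e)) = 0 := by
      rw [(F.e₁_comm' _).left_comm, ← map_mul, ← mul_assoc F.e₁, F.e₁_g_e, map_zero, mul_zero]
    have h₂ : F.p * (F.l₂ F.e₁ * (F.l₁ F.e₀ * F.l₂ (t * F.e))) =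
        F.l₁ (F.e₁ * t * F.e) * (F.l₂ F.e₀ * F.p) := by
      rw [← (F.e₀_comm F.e₁).left_comm, ← map_mul, ← mul_assoc F.p, F.p_l₁, mul_assoc, F.p_l₂,
        (F.e₀_comm' _).left_comm, mul_assoc F.e₁]
    have h₃ : F.l₁ (q * β) * F.l₂ (F.e₀ * F.g) * (F.l₁ (F.e₁ * t * F.e) * (F.l₂ F.e₀ * F.p)) =
        F.l₁ (q * β * t * F.e) * F.l₂ (F.e₀ * F.g) * F.p := by
      have hβ (y : L) : F.l₁ β * (F.l₁ F.e₁ * y) = F.l₁ β * y := by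
        rw [← mul_assoc, ← map_mul, ht.mul_e₁]
      have hg₀ (y : L) : F.l₂ F.e₀ * (F.l₂ F.g * (F.l₂ F.e₀ * y)) =
          F.l₂ F.e₀ * (F.l₂ F.g * y) := by
        rw [← mul_assoc, ← mul_assoc, ← map_mul, ← map_mul, hge, map_mul, mul_assoc]
      have hcg (k : K) (y : L) : F.l₂ F.g * (F.l₁ k * y) = F.l₁ k * (F.l₂ F.g * y) :=
        (F.g_comm' k).left_comm y
      have hce (k : K) (y : L) : F.l₂ F.e₀ * (F.l₁ k * y) = F.l₁ k * (F.l₂ F.e₀ * y) :=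
        (F.e₀_comm' k).left_comm y
      simp only [map_mul, mul_assoc, hcg, hce, hβ, hg₀]
    calc _ = F.l₁ (q * β) * F.l₂ (F.e₀ * F.g) * (F.p * (F.l₂ F.e₁ * (F.l₁ (κ * f) *
        (F.l₁ s * F.refl * F.l₂ t) * (F.l₁ F.e * F.l₂ F.e)))) := by
          simp only [mul_assoc, (F.e₁_comm' _).left_comm]
      _ = _ := by
        rw [stepκ, mul_sub, hw, ← mul_assoc _ _ F.p, h₁, zero_mul, mul_zero, sub_zero, hz, hz, hz,
          h₂, h₃]
  -- The first summand performs the row operations on both legs. As the legs do not commute, `f'`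
  -- can meet `t` only after `f` has turned `s` into the Schur complement and `κ` has removed it;
  -- `c` puts it back. The second summand removes the multiple of `β * t * e` that `rowOp_product`
  -- leaves.
  refine ⟨F.z * (F.l₁ c * F.l₂ f' * F.l₁ (κ * f)) +
    F.w * (F.l₁ (q * β) * F.l₂ (F.e₀ * F.g) * F.p * F.l₁ (κ * f) * F.l₂ F.e₁), ?_, ?_, ?_⟩
  · have hE : F.l₁ (κ * f) * (F.l₁ F.e * F.l₂ F.e) = F.l₂ F.e * F.l₁ (κ * f) := by
      rw [← mul_assoc, ← map_mul, mul_assoc, rowOp_e hs, (F.e_comm' _).eq]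
    have h₁ : F.l₁ c * F.l₂ f' * F.l₁ (κ * f) * (F.l₁ F.e * F.l₂ F.e) =
        F.l₁ c * F.l₂ f' * F.l₁ (κ * f) := by
      rw [mul_assoc, hE, ← mul_assoc, mul_assoc _ _ (F.l₂ F.e), ← map_mul, hf'e]
    have h₂ : F.l₁ (κ * f) * F.l₂ F.e₁ * (F.l₁ F.e * F.l₂ F.e) = F.l₁ (κ * f) * F.l₂ F.e₁ := by
      rw [← (F.e₁_comm' _).eq, mul_assoc, hE, ← mul_assoc, ← map_mul, F.e₁_e]
    rw [add_mul, mul_assoc F.z, h₁, mul_assoc F.w, mul_assoc _ (F.l₁ (κ * f)) (F.l₂ F.e₁),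
      mul_assoc _ (F.l₁ (κ * f) * F.l₂ F.e₁), h₂]
  · have hfe₀ : F.l₁ (κ * f) * F.l₁ F.e₀ = F.l₁ κ := by
      rw [← map_mul, mul_assoc, rowOp_e₀ hs, hs.mul_e₀]
    have h₁ : F.l₁ c * F.l₂ f' * F.l₁ (κ * f) * (F.l₁ F.e₀ * F.l₂ F.e₀) =
        F.l₁ F.e₀ * F.l₂ F.e₀ := by
      rw [mul_assoc, ← mul_assoc (F.l₁ (κ * f)), hfe₀, ← (F.e₀_comm' _).eq, mul_assoc,
        ← mul_assoc (F.l₂ f'), ← map_mul F.l₂, hf'e₀, (F.e₀_comm' _).eq, ← mul_assoc, ← map_mul,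
        hs.schur_mul]
    have h₂ : F.l₂ F.e₁ * (F.l₁ F.e₀ * F.l₂ F.e₀) = 0 := by
      rw [(F.e₁_comm' _).left_comm, ← map_mul, F.e₁_e₀, map_zero, mul_zero]
    rw [add_mul, mul_assoc F.z, h₁, mul_assoc F.w, mul_assoc _ (F.l₂ F.e₁), h₂, mul_zero, mul_zero,
      add_zero]
  · have hcg (k : K) (y : L) : F.l₂ F.g * (F.l₁ k * y) = F.l₁ k * (F.l₂ F.g * y) :=
      (F.g_comm' k).left_comm y
    have hce (k : K) (y : L) : F.l₂ F.e₀ * (F.l₁ k * y) = F.l₁ k * (F.l₂ F.e₀ * y) :=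
      (F.e₀_comm' k).left_comm y
    have hce' (k : K) (y : L) : F.l₂ k * (F.l₁ F.e₀ * y) = F.l₁ F.e₀ * (F.l₂ k * y) :=
      (F.e₀_comm k).symm.left_comm y
    have hec (y : L) : F.l₁ F.e₀ * (F.l₁ c * y) = F.l₁ c * y := by
      rw [← mul_assoc, ← map_mul, e₀_schur]
    have hce₁ (y : L) : F.l₁ c * (F.l₁ F.e₀ * y) = F.l₁ c * y := by
      rw [← mul_assoc, ← map_mul, hce₀]
    have hc'e₁ (y : L) : F.l₁ c' * (F.l₁ F.e₀ * y) = F.l₁ c' * y := by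
      rw [← mul_assoc, ← map_mul, schur_e₀]
    have hc'e₂ : F.l₂ c' * F.l₂ F.e₀ = F.l₂ c' := by
      rw [← map_mul, schur_e₀]
    have hp₁ (k : K) (y : L) : F.p * (F.l₁ k * y) = F.l₂ k * (F.p * y) := by
      rw [← mul_assoc, F.p_l₁, mul_assoc]
    have hp₂ (k : K) (y : L) : F.p * (F.l₂ k * y) = F.l₁ k * (F.p * y) := by
      rw [← mul_assoc, F.p_l₂, mul_assoc]
    have hg₀ (y : L) : F.l₂ F.e₀ * (F.l₂ F.g * (F.l₂ F.e₀ * y)) =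
        F.l₂ F.e₀ * (F.l₂ F.g * y) := by
      rw [← mul_assoc, ← mul_assoc, ← map_mul, ← map_mul, hge, map_mul, mul_assoc]
    have h₁ : F.l₁ F.e₀ * F.l₂ F.e₀ * (F.l₁ c * F.l₂ c') * (F.l₁ F.e₀ * F.l₂ F.e₀) =
        F.l₁ c * F.l₂ c' := by
      have hec₂ : F.l₂ F.e₀ * F.l₂ c' = F.l₂ c' := by rw [← map_mul, e₀_schur]
      simp only [mul_assoc, hce, hce', hec, hce₁, hec₂, hc'e₂]
    have h₂ : F.l₁ F.e₀ * F.l₂ F.e₀ * (F.l₁ c * (F.l₁ F.g * F.l₂ F.g * F.p) * F.l₂ c') *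
        (F.l₁ F.e₀ * F.l₂ F.e₀) = F.l₁ (c * F.g * c') * F.l₂ (F.e₀ * F.g) * F.p := by
      have hpe : F.p * F.l₂ F.e₀ = F.l₁ F.e₀ * F.p := F.p_l₂ _
      simp only [mul_assoc, map_mul, hce, hce', hcg, hec, hp₁, hp₂, hpe, hc'e₁, hg₀]
    have h₃ : F.w * (F.z * (F.l₁ (q * β * t * F.e) * F.l₂ (F.e₀ * F.g) * F.p)) =
        F.z * (F.w * (F.l₁ (q * β * t * F.e) * F.l₂ (F.e₀ * F.g) * F.p)) := hz _ _
    calc _ = F.z * (F.l₁ c * F.l₂ f' * F.l₁ (κ * f) * (F.l₁ s * F.refl * F.l₂ t) *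
          (F.l₁ F.e * F.l₂ F.e)) +
        F.w * (F.l₁ (q * β) * F.l₂ (F.e₀ * F.g) * F.p * F.l₁ (κ * f) * F.l₂ F.e₁ *
          (F.l₁ s * F.refl * F.l₂ t) * (F.l₁ F.e * F.l₂ F.e)) := by
          simp only [add_mul, mul_assoc]
      _ = F.z * (F.z * (F.l₁ c * F.l₂ c') -
          F.w * (F.l₁ (c * F.g * c') * F.l₂ (F.e₀ * F.g) * F.p)) := by
        rw [stepA, stepB, hqe, h₃]
        simp only [map_add, add_mul, mul_add, mul_sub]
        abel
      _ = _ := by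
        have hz₁ (k : K) (y : L) : F.l₁ k * (F.z * y) = F.z * (F.l₁ k * y) := hz _ _
        have hz₂ (k : K) (y : L) : F.l₂ k * (F.z * y) = F.z * (F.l₂ k * y) := hz _ _
        have hw₁ (k : K) (y : L) : F.l₁ k * (F.w * y) = F.w * (F.l₁ k * y) := hw _ _
        have hw₂ (k : K) (y : L) : F.l₂ k * (F.w * y) = F.w * (F.l₂ k * y) := hw _ _
        rw [← h₂, ← h₁]
        simp only [mul_assoc, refl, mul_sub, sub_mul, hz₁, hz₂, hw₁, hw₂]

/-- The mirror image of `exists_left_elim`, with column operations instead of row operations. -/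
theorem exists_right_elim (hs : Pivot F.e₀ F.e₁ s α κ) {κ' : K} (ht : Pivot F.e₀ F.e₁ t β κ') :
    ∃ ψ : L, F.l₁ F.e * F.l₂ F.e * ψ = ψ ∧
      F.l₁ F.e₀ * F.l₂ F.e₀ * ψ = F.z * (F.l₁ F.e₀ * F.l₂ F.e₀) ∧
      F.l₁ F.e * F.l₂ F.e * (F.l₁ s * F.refl * F.l₂ t) * ψ =
        F.z * (F.l₁ F.e₀ * F.l₂ F.e₀ * (F.l₁ (schur F.e₀ s α) * F.refl * F.l₂ (schur F.e₀ t β)) *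
          (F.l₁ F.e₀ * F.l₂ F.e₀)) := by
  obtain ⟨φ, h₁, h₂, h₃⟩ := exists_left_elim (F := F.op) ht.op hs.op
  have hop₁ (k : K) : F.op.l₁ (MulOpposite.op k) = MulOpposite.op (F.l₂ k) := rfl
  have hop₂ (k : K) : F.op.l₂ (MulOpposite.op k) = MulOpposite.op (F.l₁ k) := rfl
  have hope : F.op.e = MulOpposite.op F.e := rfl
  have hope₀ : F.op.e₀ = MulOpposite.op F.e₀ := rfl
  have hopz : F.op.z = MulOpposite.op F.z := rfl
  simp only [hope, hope₀, hopz, schur_op, refl_op, hop₁, hop₂, ← MulOpposite.op_mul] at h₁ h₂ h₃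
  replace h₁ := congrArg MulOpposite.unop h₁
  replace h₂ := congrArg MulOpposite.unop h₂
  replace h₃ := congrArg MulOpposite.unop h₃
  simp only [MulOpposite.unop_mul, MulOpposite.unop_op] at h₁ h₂ h₃
  refine ⟨φ.unop, h₁, ?_, ?_⟩
  · rw [h₂, (F.z_comm _).eq]
  · rw [(F.z_comm _).eq]
    simpa only [mul_assoc] using h₃

/-- If `s`, `t` satisfy the reflection equation with an `R` that commutes with `e ⊗ e` and
`e₀ ⊗ e₀`, then so do their Schur complements. Each side of the equation for `s`, `t`, multiplied by
the left and the right elimination factors, is `z²` times the corresponding side for the Schur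
complements. -/
theorem schur_reflection (hs : Pivot F.e₀ F.e₁ s α κ) {κ' : K} (ht : Pivot F.e₀ F.e₁ t β κ')
    (hz : ∀ x, F.z * x = 0 → x = 0) {R : L} (hR : Commute R (F.l₁ F.e * F.l₂ F.e))
    (hR₀ : Commute R (F.l₁ F.e₀ * F.l₂ F.e₀))
    (h : R * (F.l₁ s * F.refl * F.l₂ t) = F.l₂ t * F.refl * F.l₁ s * R) :
    R * (F.l₁ F.e₀ * F.l₂ F.e₀ * (F.l₁ (schur F.e₀ s α) * F.refl * F.l₂ (schur F.e₀ t β)) *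
          (F.l₁ F.e₀ * F.l₂ F.e₀)) =
      F.l₁ F.e₀ * F.l₂ F.e₀ * (F.l₂ (schur F.e₀ t β) * F.refl * F.l₁ (schur F.e₀ s α)) *
          (F.l₁ F.e₀ * F.l₂ F.e₀) * R := by
  obtain ⟨ψ, hψ, hψ₀, hψs⟩ := exists_right_elim hs ht
  obtain ⟨φ, hφ, hφ₀, hφs⟩ := exists_left_elim (F := F.swap) ht hs
  have hE : F.l₂ F.e * F.l₁ F.e = F.l₁ F.e * F.l₂ F.e := (F.e_comm' _).eq
  have hE₀ : F.l₂ F.e₀ * F.l₁ F.e₀ = F.l₁ F.e₀ * F.l₂ F.e₀ := (F.e₀_comm' _).eq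
  rw [F.swap_refl] at hφs
  change φ * (F.l₂ F.e * F.l₁ F.e) = φ at hφ
  change φ * (F.l₂ F.e₀ * F.l₁ F.e₀) = F.z * (F.l₂ F.e₀ * F.l₁ F.e₀) at hφ₀
  change φ * (F.l₂ t * F.refl * F.l₁ s) * (F.l₂ F.e * F.l₁ F.e) =
        F.z * (F.l₂ F.e₀ * F.l₁ F.e₀ * (F.l₂ (schur F.e₀ t β) * F.refl * F.l₁ (schur F.e₀ s α)) *
          (F.l₂ F.e₀ * F.l₁ F.e₀)) at hφs
  rw [hE] at hφ hφs
  rw [hE₀] at hφ₀ hφs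
  have hE₀E₀ : F.l₁ F.e₀ * F.l₂ F.e₀ * (F.l₁ F.e₀ * F.l₂ F.e₀) = F.l₁ F.e₀ * F.l₂ F.e₀ := by
    rw [mul_assoc, (F.e₀_comm' _).left_comm, ← mul_assoc, ← map_mul, ← map_mul, F.e₀_e₀]
  generalize F.l₁ F.e * F.l₂ F.e = E at *
  generalize F.l₁ F.e₀ * F.l₂ F.e₀ = E₀ at *
  generalize F.l₁ s * F.refl * F.l₂ t = Z at *
  generalize F.l₂ t * F.refl * F.l₁ s = Z' at *
  generalize F.l₁ (schur F.e₀ s α) * F.refl * F.l₂ (schur F.e₀ t β) = X at *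
  generalize F.l₂ (schur F.e₀ t β) * F.refl * F.l₁ (schur F.e₀ s α) = Y at *
  have h₁ : φ * R * Z * ψ = F.z * (F.z * (R * (E₀ * X * E₀))) := by
    calc φ * R * Z * ψ = φ * (E * R) * Z * ψ := by rw [← mul_assoc, hφ]
      _ = φ * R * (E * Z * ψ) := by rw [← hR.eq]; simp only [mul_assoc]
      _ = F.z * (φ * (R * (E₀ * (E₀ * X * E₀)))) := by
        rw [hψs, ← mul_assoc, ← (F.z_comm _).eq, mul_assoc F.z, mul_assoc E₀ X,
          ← mul_assoc E₀ E₀, hE₀E₀, mul_assoc φ]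
      _ = F.z * (φ * E₀ * (R * (E₀ * X * E₀))) := by
        rw [← mul_assoc R, hR₀.eq]; simp only [mul_assoc]
      _ = F.z * (F.z * (R * (E₀ * X * E₀))) := by
        rw [hφ₀, mul_assoc F.z, ← mul_assoc E₀ R, ← hR₀.eq, mul_assoc R, mul_assoc E₀ X,
          ← mul_assoc E₀ E₀, hE₀E₀]
  have h₂ : φ * Z' * R * ψ = F.z * (F.z * (E₀ * Y * E₀ * R)) := by
    calc φ * Z' * R * ψ = φ * Z' * (R * (E * ψ)) := by rw [hψ, mul_assoc]
      _ = φ * Z' * E * R * ψ := by rw [← mul_assoc R, hR.eq]; simp only [mul_assoc]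
      _ = F.z * (E₀ * Y * E₀ * E₀ * R * ψ) := by
        rw [hφs, mul_assoc _ E₀ E₀, hE₀E₀]; simp only [mul_assoc]
      _ = F.z * (E₀ * Y * E₀ * R * (E₀ * ψ)) := by
        rw [mul_assoc _ E₀ R, ← hR₀.eq]; simp only [mul_assoc]
      _ = F.z * (F.z * (E₀ * Y * E₀ * R)) := by
        rw [hψ₀, ← mul_assoc _ F.z, ← (F.z_comm _).eq, mul_assoc F.z, mul_assoc _ R, hR₀.eq,
          ← mul_assoc _ E₀, mul_assoc _ E₀ E₀, hE₀E₀]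
  rw [← sub_eq_zero]
  apply hz
  apply hz
  rw [mul_sub, mul_sub, ← h₁, ← h₂, sub_eq_zero, mul_assoc φ, h, ← mul_assoc]

/-- The conclusion of `schur_reflection` with the idempotent `e₀ ⊗ e₀` between all factors, so that
it descends to the corner. -/
theorem schur_reflection_compressed (hs : Pivot F.e₀ F.e₁ s α κ) {κ' : K}
    (ht : Pivot F.e₀ F.e₁ t β κ')
    (hz : ∀ x, F.z * x = 0 → x = 0) {R : L} (hR : Commute R (F.l₁ F.e * F.l₂ F.e))
    (hR₀ : Commute R (F.l₁ F.e₀ * F.l₂ F.e₀))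
    (h : R * (F.l₁ s * F.refl * F.l₂ t) = F.l₂ t * F.refl * F.l₁ s * R) :
    R * (F.l₁ F.e₀ * F.l₂ F.e₀) * F.l₁ (schur F.e₀ s α) * (F.l₁ F.e₀ * F.l₂ F.e₀) * F.refl *
        (F.l₁ F.e₀ * F.l₂ F.e₀) * F.l₂ (schur F.e₀ t β) =
      F.l₂ (schur F.e₀ t β) * (F.l₁ F.e₀ * F.l₂ F.e₀) * F.refl * (F.l₁ F.e₀ * F.l₂ F.e₀) *
        F.l₁ (schur F.e₀ s α) * (F.l₁ F.e₀ * F.l₂ F.e₀) * R := by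
  have key := schur_reflection hs ht hz hR hR₀ h
  have hE₀E₀ : F.l₁ F.e₀ * F.l₂ F.e₀ * (F.l₁ F.e₀ * F.l₂ F.e₀) = F.l₁ F.e₀ * F.l₂ F.e₀ := by
    rw [mul_assoc, (F.e₀_comm' _).left_comm, ← mul_assoc, ← map_mul, ← map_mul, F.e₀_e₀]
  have h₁ : Commute (F.l₁ F.e₀ * F.l₂ F.e₀) (F.l₁ (schur F.e₀ s α)) := by
    rw [Commute, SemiconjBy, mul_assoc, (F.e₀_comm' _).eq, ← mul_assoc, ← mul_assoc, ← map_mul,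
      ← map_mul, e₀_schur, schur_e₀]
  have h₂ : Commute (F.l₁ F.e₀ * F.l₂ F.e₀) (F.l₂ (schur F.e₀ t β)) := by
    rw [(F.e₀_comm _).eq, Commute, SemiconjBy, mul_assoc, (F.e₀_comm _).eq, ← mul_assoc,
      ← mul_assoc, ← map_mul, ← map_mul, e₀_schur, schur_e₀]
  generalize F.l₁ F.e₀ * F.l₂ F.e₀ = E₀ at *
  have h₁' (y : L) : E₀ * (F.l₁ (schur F.e₀ s α) * y) = F.l₁ (schur F.e₀ s α) * (E₀ * y) :=
    h₁.left_comm y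
  have h₂' (y : L) : E₀ * (F.l₂ (schur F.e₀ t β) * y) = F.l₂ (schur F.e₀ t β) * (E₀ * y) :=
    h₂.left_comm y
  have hEE (y : L) : E₀ * (E₀ * y) = E₀ * y := by rw [← mul_assoc, hE₀E₀]
  simpa only [mul_assoc, h₁', h₂', h₁.eq, h₂.eq, hEE, hE₀E₀] using key

end LegFrame

/-! ### Power series in one and two variables -/

section Series
variable {A : Type*} [Ring A]

theorem coeff_inVar (a : Fin 2) (f : PowerSeries A) (d : Fin 2 →₀ ℕ) :
    MvPowerSeries.coeff d (inVar a f) =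
      if d = Finsupp.single a (d a) then PowerSeries.coeff (d a) f else 0 := rfl

theorem coeff_inVar_mul_inVar {a b : Fin 2} (hab : a ≠ b) (f g : PowerSeries A)
    (d : Fin 2 →₀ ℕ) :
    MvPowerSeries.coeff d (inVar a f * inVar b g) =
      PowerSeries.coeff (d a) f * PowerSeries.coeff (d b) g := by
  classical
  rw [MvPowerSeries.coeff_mul]
  have hd : d = Finsupp.single a (d a) + Finsupp.single b (d b) := by
    ext i; fin_cases a <;> fin_cases b <;> fin_cases i <;> simp_all
  rw [Finset.sum_eq_single (Finsupp.single a (d a), Finsupp.single b (d b))]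
  · simp [coeff_inVar]
  · rintro ⟨k, l⟩ hkl hne
    rw [Finset.HasAntidiagonal.mem_antidiagonal] at hkl
    rw [coeff_inVar, coeff_inVar]
    by_cases hk : k = Finsupp.single a (k a)
    · by_cases hl : l = Finsupp.single b (l b)
      · refine absurd ?_ hne
        have ha : k a = d a := by rw [← hkl, hl]; simp [hab]
        have hb : l b = d b := by rw [← hkl, hk]; simp [hab.symm]
        rw [hk, hl, ha, hb]
      · rw [if_neg hl, mul_zero]
    · rw [if_neg hk, zero_mul]
  · intro h; exact absurd (Finset.HasAntidiagonal.mem_antidiagonal.2 hd.symm) h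

theorem inVar_mul (a : Fin 2) (f g : PowerSeries A) :
    inVar a (f * g) = inVar a f * inVar a g := by
  classical
  ext d
  rw [MvPowerSeries.coeff_mul]
  simp only [coeff_inVar]
  split_ifs with hd
  · rw [PowerSeries.coeff_mul]
    have : Finset.HasAntidiagonal.antidiagonal d = (Finset.HasAntidiagonal.antidiagonal (d a)).map
        ⟨Prod.map (Finsupp.single a) (Finsupp.single a),
          (Finsupp.single_injective a).prodMap (Finsupp.single_injective a)⟩ := by
      conv_lhs => rw [hd]
      exact Finsupp.antidiagonal_single a (d a)
    rw [this, Finset.sum_map]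
    simp
  · symm
    apply Finset.sum_eq_zero
    rintro ⟨b, c⟩ hbc
    rw [Finset.HasAntidiagonal.mem_antidiagonal] at hbc
    by_cases hb : b = Finsupp.single a (b a)
    · by_cases hc : c = Finsupp.single a (c a)
      · exfalso; apply hd
        rw [← hbc, Finsupp.add_apply, Finsupp.single_add, ← hb, ← hc]
      · simp only [if_neg hc, mul_zero]
    · simp only [if_neg hb, zero_mul]

variable (A) in
/-- The map `inVar a` as a ring homomorphism. -/
def inVarHom (a : Fin 2) : PowerSeries A →+* MvPowerSeries (Fin 2) A where
  toFun := inVar a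
  map_one' := by
    ext d
    classical
    simp only [coeff_inVar, PowerSeries.coeff_one, MvPowerSeries.coeff_one]
    by_cases h : d = 0
    · simp [h]
    · rw [if_neg h]
      split_ifs with h1 h2
      · rw [h2, Finsupp.single_zero] at h1; exact absurd h1 h
      · rfl
      · rfl
  map_mul' := inVar_mul a
  map_zero' := by
    ext d
    simp [coeff_inVar]
  map_add' f g := by
    ext d
    simp only [map_add, coeff_inVar]
    split_ifs <;> simp

theorem inVarHom_apply (a : Fin 2) (f : PowerSeries A) : inVarHom A a f = inVar a f := rfl

theorem inVar_X (a : Fin 2) : inVar a (PowerSeries.X : PowerSeries A) = MvPowerSeries.X a := by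
  classical
  ext d
  simp only [MvPowerSeries.coeff_X, coeff_inVar, PowerSeries.coeff_X]
  by_cases h : d = Finsupp.single a 1
  · simp [h]
  · rw [if_neg h]
    split_ifs with h1 h2
    · rw [h2] at h1; exact absurd h1 h
    · rfl
    · rfl

theorem map_inVar {B : Type*} [Ring B] (φ : A →+* B) (a : Fin 2) (f : PowerSeries A) :
    MvPowerSeries.map φ (inVar a f) = inVar a (PowerSeries.map φ f) := by
  ext d
  simp only [MvPowerSeries.coeff_map, coeff_inVar, PowerSeries.coeff_map]
  split_ifs <;> simp

/-- The element `X 1 + X 0` is not a left zero divisor: in `(X 1 + X 0) f = 0` each coefficient of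
`f` is determined by coefficients of smaller degree in `X 1`. -/
theorem eq_zero_of_add_X_mul_eq_zero {f : MvPowerSeries (Fin 2) A}
    (h : (MvPowerSeries.X 1 + MvPowerSeries.X 0) * f = 0) : f = 0 := by
  classical
  suffices ∀ n, ∀ d : Fin 2 →₀ ℕ, d 1 = n → MvPowerSeries.coeff d f = 0 from
    MvPowerSeries.ext fun d => by rw [this _ d rfl, map_zero]
  intro n
  induction n with
  | zero =>
    intro d hd
    have := congrArg (MvPowerSeries.coeff (Finsupp.single 0 1 + d)) h
    rw [add_mul, map_add, MvPowerSeries.X_def, MvPowerSeries.X_def,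
      MvPowerSeries.coeff_add_monomial_mul, MvPowerSeries.coeff_monomial_mul, if_neg] at this
    · simpa using this
    · intro hle
      have := hle 1
      simp [hd] at this
  | succ n ih =>
    intro d hd
    have := congrArg (MvPowerSeries.coeff (Finsupp.single 0 1 + d)) h
    rw [add_mul, map_add, MvPowerSeries.X_def, MvPowerSeries.X_def,
      MvPowerSeries.coeff_add_monomial_mul, MvPowerSeries.coeff_monomial_mul, ih] at this
    · simpa using this
    · simp [hd]

end Series

/-! ### Matrices of power series -/

section Matrices
variable {A : Type*} [Ring A]

/-- A power series with matrix coefficients, viewed as a matrix of power series. -/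
def matrixOfSeries (n : Type*) [Fintype n] [DecidableEq n] :
    PowerSeries (Matrix n n A) →+* Matrix n n (PowerSeries A) where
  toFun f := Matrix.of fun i j => PowerSeries.mk fun r => PowerSeries.coeff r f i j
  map_one' := by
    ext i j r
    by_cases hij : i = j <;> by_cases hr : r = 0 <;>
      simp [PowerSeries.coeff_one, Matrix.one_apply, hij, hr]
  map_zero' := by ext i j r; simp
  map_add' f g := by ext i j r; simp
  map_mul' f g := by
    ext i j r
    simp only [Matrix.of_apply, PowerSeries.coeff_mk, PowerSeries.coeff_mul, Matrix.mul_apply,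
      map_sum, Matrix.sum_apply]
    rw [Finset.sum_comm]

/-- A matrix of power series is a power series of matrices, and these are invertible when the
constant coefficient is. -/
theorem isUnit_of_map_constantCoeff_eq_one {n : Type*} [Fintype n] [DecidableEq n]
    {M : Matrix n n (PowerSeries A)} (h : PowerSeries.constantCoeff.mapMatrix M = 1) :
    IsUnit M := by
  let f : PowerSeries (Matrix n n A) :=
    PowerSeries.mk fun r => M.map (PowerSeries.coeff r)
  have hf : matrixOfSeries n f = M := by
    ext i j r
    simp [matrixOfSeries, f]
  rw [← hf]
  refine IsUnit.map _ (PowerSeries.isUnit_iff_constantCoeff.2 ?_)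
  have : PowerSeries.constantCoeff f = 1 := by
    rw [← h]
    ext i j
    simp [f]
  rw [this]; exact isUnit_one

end Matrices

/-! ### Existence of pivots -/

section Pivots

theorem Pivot.map {K K' : Type*} [Ring K] [Ring K'] (φ : K →+* K') {e₀ e₁ s α κ : K}
    (h : Pivot e₀ e₁ s α κ) : Pivot (φ e₀) (φ e₁) (φ s) (φ α) (φ κ) := by
  have hs : schur (φ e₀) (φ s) (φ α) = φ (schur e₀ s α) := by simp [schur]
  refine ⟨?_, ?_, ?_, ?_, ?_, ?_, ?_, ?_⟩ <;> (try rw [hs]) <;>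
    simp only [← map_mul, h.e₁_mul, h.mul_e₁, h.right_inv, h.left_inv, h.e₀_mul, h.mul_e₀,
      h.schur_mul, h.mul_schur]

theorem map_schur {K K' : Type*} [Ring K] [Ring K'] (φ : K →+* K') (e₀ s α : K) :
    φ (schur e₀ s α) = schur (φ e₀) (φ s) (φ α) := by simp [schur]

/-- An element `a` of the corner ring `e K e` is invertible there when `a + (1 - e)` is a unit
of `K`. -/
theorem exists_corner_inverse {K : Type*} [Ring K] {e a : K} (he : e * e = e) (hea : e * a = a)
    (hae : a * e = a) (hu : IsUnit (a + (1 - e))) :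
    ∃ b, e * b = b ∧ b * e = b ∧ a * b = e ∧ b * a = e := by
  obtain ⟨u, hu⟩ := hu
  have h₁ : e * u = a := by rw [hu, mul_add, hea, mul_sub, he, mul_one, sub_self, add_zero]
  have h₂ : u * e = a := by rw [hu, add_mul, hae, sub_mul, he, one_mul, sub_self, add_zero]
  have hc : e * (↑u⁻¹ : K) = ↑u⁻¹ * e := by
    rw [Units.mul_inv_eq_iff_eq_mul, mul_assoc, Units.eq_inv_mul_iff_mul_eq, h₁, h₂]
  refine ⟨e * ↑u⁻¹, by rw [← mul_assoc, he], by rw [hc, mul_assoc, he], ?_, ?_⟩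
  · rw [← mul_assoc, hae, ← h₁, mul_assoc, Units.mul_inv, mul_one]
  · rw [hc, mul_assoc, hea, ← h₂, ← mul_assoc, Units.inv_mul, one_mul]

/-- Over a ring in which `ε k = 1` makes `k` a unit, every `s` with `ε s = 1` admits the inverses
that the Schur complement needs. -/
theorem exists_pivot {K K' : Type*} [Ring K] [Ring K'] (ε : K →+* K')
    (hε : ∀ k, ε k = 1 → IsUnit k) {e₀ e₁ s : K} (h₀₀ : e₀ * e₀ = e₀) (h₁₁ : e₁ * e₁ = e₁)
    (h₁₀ : e₁ * e₀ = 0) (hs : ε s = 1) : ∃ α κ, Pivot e₀ e₁ s α κ ∧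
      ε (schur e₀ s α) = ε e₀ := by
  have hε₁ : ε e₁ * ε e₁ = ε e₁ := by rw [← map_mul, h₁₁]
  have hε₀ : ε e₀ * ε e₀ = ε e₀ := by rw [← map_mul, h₀₀]
  obtain ⟨α, hα₁, hα₂, hα₃, hα₄⟩ := exists_corner_inverse (a := e₁ * s * e₁) h₁₁
    (by simp only [← mul_assoc, h₁₁]) (by simp only [mul_assoc, h₁₁])
    (hε _ (by simp only [map_add, map_mul, map_sub, map_one, hs, mul_one, hε₁, add_sub_cancel]))
  have hα₀ : α * e₀ = 0 := by rw [← hα₂, mul_assoc, h₁₀, mul_zero]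
  have hc : ε (schur e₀ s α) = ε e₀ := by
    have : ε α * ε e₀ = 0 := by rw [← map_mul, hα₀, map_zero]
    simp only [schur, map_sub, map_mul, hs, one_mul, mul_assoc, this, mul_zero, sub_zero, hε₀]
  obtain ⟨κ, hκ₁, hκ₂, hκ₃, hκ₄⟩ := exists_corner_inverse (a := schur e₀ s α) h₀₀
    (by simp only [schur, mul_sub, ← mul_assoc, h₀₀])
    (by simp only [schur, sub_mul, mul_assoc, h₀₀])
    (hε _ (by simp [hc]))
  refine ⟨α, κ, ⟨hα₁, hα₂, ?_, ?_, hκ₁, hκ₂, hκ₃, hκ₄⟩, hc⟩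
  · rw [mul_assoc _ e₁, hα₁] at hα₃
    exact hα₃
  · rw [← mul_assoc, ← mul_assoc, hα₂] at hα₄
    exact hα₄

end Pivots

/-! ### The tensor square of the matrix ring -/

section Legs
variable {N : ℕ} {W : Type*} [Ring W]

variable (N W) in
/-- The embedding `M ↦ M ⊗ 1` on the first leg. -/
def legHom₁ : Matrix (Fin N) (Fin N) W →+* Matrix (Fin N × Fin N) (Fin N × Fin N) W where
  toFun M := M ⊗ₖ 1
  map_one' := Matrix.one_kronecker_one
  map_zero' := Matrix.zero_kronecker _
  map_add' M M' := Matrix.add_kronecker _ _ _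
  map_mul' M M' := by simp only [Matrix.kronecker_one, ← Matrix.blockDiagonal_mul]

variable (N W) in
/-- The embedding `M ↦ 1 ⊗ M` on the second leg. -/
def legHom₂ : Matrix (Fin N) (Fin N) W →+* Matrix (Fin N × Fin N) (Fin N × Fin N) W where
  toFun M := 1 ⊗ₖ M
  map_one' := Matrix.one_kronecker_one
  map_zero' := Matrix.kronecker_zero _
  map_add' M M' := Matrix.kronecker_add _ _ _
  map_mul' M M' := by
    simp only [Matrix.one_kronecker, Matrix.reindex_apply, Matrix.submatrix_mul_equiv,
      ← Matrix.blockDiagonal_mul]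

theorem legHom₁_apply (M : Matrix (Fin N) (Fin N) W) (a b : Fin N × Fin N) :
    legHom₁ N W M a b = if a.2 = b.2 then M a.1 b.1 else 0 := by
  simp [legHom₁, Matrix.one_apply]

theorem legHom₂_apply (M : Matrix (Fin N) (Fin N) W) (a b : Fin N × Fin N) :
    legHom₂ N W M a b = if a.1 = b.1 then M a.2 b.2 else 0 := by
  simp [legHom₂, Matrix.one_apply]

theorem legHom₁_mul_legHom₂ (M M' : Matrix (Fin N) (Fin N) W) (a b : Fin N × Fin N) :
    (legHom₁ N W M * legHom₂ N W M') a b = M a.1 b.1 * M' a.2 b.2 := by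
  simp [Matrix.mul_apply, Fintype.sum_prod_type, legHom₁_apply, legHom₂_apply]

theorem legHom₂_mul_legHom₁ (M M' : Matrix (Fin N) (Fin N) W) (a b : Fin N × Fin N) :
    (legHom₂ N W M' * legHom₁ N W M) a b = M' a.2 b.2 * M a.1 b.1 := by
  simp [Matrix.mul_apply, Fintype.sum_prod_type, legHom₁_apply, legHom₂_apply]

theorem swapMat_apply (a b : Fin N × Fin N) :
    swapMat N W a b = if a.swap = b then 1 else 0 := by
  obtain ⟨i, k⟩ := a
  obtain ⟨j, l⟩ := b
  simp [swapMat, Matrix.sum_apply, Matrix.single_apply, Prod.ext_iff, ite_and]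
  split_ifs <;> simp_all

theorem swapMat_mul {n : Type*} (M : Matrix (Fin N × Fin N) n W) :
    swapMat N W * M = M.submatrix Prod.swap id := by
  ext a b
  simp [Matrix.mul_apply, swapMat_apply]

theorem mul_swapMat {n : Type*} (M : Matrix n (Fin N × Fin N) W) :
    M * swapMat N W = M.submatrix id Prod.swap := by
  ext a b
  simp [Matrix.mul_apply, swapMat_apply, Prod.swap_eq_iff_eq_swap]

theorem antiDiag_mul {n : Type*} (M : Matrix (Fin N) n W) :
    antiDiag N W * M = M.submatrix Fin.rev id := by
  ext a b
  simp [Matrix.mul_apply, antiDiag, eq_comm (a := a), Fin.rev_eq_iff]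

theorem mul_antiDiag {n : Type*} (M : Matrix n (Fin N) W) :
    M * antiDiag N W = M.submatrix id Fin.rev := by
  ext a b
  simp [Matrix.mul_apply, antiDiag]

theorem antiDiag_mul_self : antiDiag N W * antiDiag N W = 1 := by
  rw [antiDiag_mul]
  ext i j
  simp [antiDiag, Matrix.one_apply, Fin.rev_inj]

theorem legHom_commute {M : Matrix (Fin N) (Fin N) W} (hM : ∀ i j w, Commute (M i j) w)
    (M' : Matrix (Fin N) (Fin N) W) : Commute (legHom₁ N W M) (legHom₂ N W M') := by
  ext a b
  rw [legHom₁_mul_legHom₂, legHom₂_mul_legHom₁, (hM _ _ _).eq]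

theorem legHom_commute' {M : Matrix (Fin N) (Fin N) W} (hM : ∀ i j w, Commute (M i j) w)
    (M' : Matrix (Fin N) (Fin N) W) : Commute (legHom₂ N W M) (legHom₁ N W M') := by
  ext a b
  rw [legHom₁_mul_legHom₂, legHom₂_mul_legHom₁, (hM _ _ _).eq]

theorem commute_ite_one_zero (p : Prop) [Decidable p] (w : W) :
    Commute (if p then (1 : W) else 0) w := by
  split_ifs
  · exact Commute.one_left w
  · exact Commute.zero_left w

theorem commute_smul_one {n : Type*} [Fintype n] [DecidableEq n] {a : W} (ha : ∀ w, Commute a w)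
    (M : Matrix n n W) : Commute (a • (1 : Matrix n n W)) M := by
  rw [Commute, SemiconjBy, smul_mul_assoc, one_mul]
  ext i j
  simp [Matrix.mul_apply, Matrix.one_apply, (ha _).eq]

/-- The diagonal idempotent of the indices that satisfy `p`. -/
def indicatorMat (N : ℕ) (W : Type*) [Ring W] (p : Fin N → Prop) [DecidablePred p] :
    Matrix (Fin N) (Fin N) W :=
  Matrix.diagonal fun i => if p i then 1 else 0

theorem indicatorMat_mul (p q : Fin N → Prop) [DecidablePred p] [DecidablePred q] :
    indicatorMat N W p * indicatorMat N W q = indicatorMat N W fun i => p i ∧ q i := by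
  rw [indicatorMat, indicatorMat, Matrix.diagonal_mul_diagonal, indicatorMat]
  congr 1
  ext i
  by_cases hp : p i <;> simp [hp]

theorem indicatorMat_mul_self (p : Fin N → Prop) [DecidablePred p] :
    indicatorMat N W p * indicatorMat N W p = indicatorMat N W p := by
  rw [indicatorMat, Matrix.diagonal_mul_diagonal]
  exact congrArg _ (funext fun i => by split_ifs <;> simp)

theorem indicatorMat_false (p : Fin N → Prop) [DecidablePred p] (h : ∀ i, ¬ p i) :
    indicatorMat N W p = 0 := by
  simp [indicatorMat, h]

theorem indicatorMat_commute (p : Fin N → Prop) [DecidablePred p] (i j : Fin N) (w : W) :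
    Commute (indicatorMat N W p i j) w := by
  rw [indicatorMat, Matrix.diagonal_apply]
  split_ifs
  · exact Commute.one_left w
  · exact Commute.zero_left w
  · exact Commute.zero_left w

/-- The idempotent of the middle indices, those that are neither among the first `m` nor among the
last `m`. -/
def midMat (N m : ℕ) (W : Type*) [Ring W] : Matrix (Fin N) (Fin N) W :=
  indicatorMat N W fun i => m ≤ i ∧ i + m < N

/-- The idempotent of the first `m` indices. -/
def topMat (N m : ℕ) (W : Type*) [Ring W] : Matrix (Fin N) (Fin N) W :=
  indicatorMat N W fun i => (i : ℕ) < m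

theorem midMat_mul_self (m : ℕ) : midMat N m W * midMat N m W = midMat N m W :=
  indicatorMat_mul_self _

theorem topMat_mul_self (m : ℕ) : topMat N m W * topMat N m W = topMat N m W :=
  indicatorMat_mul_self _

theorem midMat_mul_topMat (m : ℕ) : midMat N m W * topMat N m W = 0 := by
  rw [midMat, topMat, indicatorMat_mul, indicatorMat_false]
  intro i; omega

theorem topMat_mul_midMat (m : ℕ) : topMat N m W * midMat N m W = 0 := by
  rw [midMat, topMat, indicatorMat_mul, indicatorMat_false]
  intro i; omega

/-- The frame of `N × N` matrices, with `g = antiDiag N W`, which reverses the indices, and the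
idempotents of the middle and the first `m` indices. -/
def matFrame {m : ℕ} (hm : 2 * m ≤ N) (a b : W) (ha : ∀ w, Commute a w) (hb : ∀ w, Commute b w) :
    LegFrame (Matrix (Fin N) (Fin N) W) (Matrix (Fin N × Fin N) (Fin N × Fin N) W) where
  l₁ := legHom₁ N W
  l₂ := legHom₂ N W
  p := swapMat N W
  z := a • 1
  w := b • 1
  g := antiDiag N W
  e₀ := midMat N m W
  e₁ := topMat N m W
  p_l₁ k := by
    rw [swapMat_mul, mul_swapMat]
    ext a b
    simp [legHom₁_apply, legHom₂_apply]
  p_l₂ k := by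
    rw [swapMat_mul, mul_swapMat]
    ext a b
    simp [legHom₁_apply, legHom₂_apply]
  z_comm := commute_smul_one ha
  w_comm := commute_smul_one hb
  g_comm := legHom_commute fun _ _ => commute_ite_one_zero _
  g_comm' := legHom_commute' fun _ _ => commute_ite_one_zero _
  e₀_comm := legHom_commute (indicatorMat_commute _)
  e₀_comm' := legHom_commute' (indicatorMat_commute _)
  e₁_comm := legHom_commute (indicatorMat_commute _)
  e₁_comm' := legHom_commute' (indicatorMat_commute _)
  e₀_e₀ := midMat_mul_self m
  e₁_e₁ := topMat_mul_self m
  e₀_e₁ := midMat_mul_topMat m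
  e₁_e₀ := topMat_mul_midMat m
  g_e₀ := by
    rw [antiDiag_mul, mul_antiDiag]
    ext i j
    simp only [midMat, indicatorMat, Matrix.submatrix_apply, Matrix.diagonal_apply, id,
      Fin.rev_eq_iff, Fin.val_rev]
    split_ifs <;> first | rfl | omega
  g_e₁ := by
    rw [antiDiag_mul, mul_antiDiag]
    ext i j
    simp only [midMat, topMat, indicatorMat, Matrix.submatrix_apply, Matrix.diagonal_apply, id,
      Matrix.sub_apply, Matrix.one_apply]
    have h : i.rev = j ↔ i = j.rev := Fin.rev_eq_iff
    by_cases hij : i = j.rev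
    · simp only [hij, if_true, Fin.rev_rev, Fin.val_rev]
      split_ifs <;> first | omega | simp
    · simp [h, hij]

/-- The frame of the quaternary relation, in which `z = v⁻¹ + u⁻¹` and `w = u⁻¹ v⁻¹`. -/
abbrev quatFrame {m : ℕ} (hm : 2 * m ≤ N) (A : Type*) [Ring A] :
    LegFrame (Matrix (Fin N) (Fin N) (MvPowerSeries (Fin 2) A))
      (Matrix (Fin N × Fin N) (Fin N × Fin N) (MvPowerSeries (Fin 2) A)) :=
  matFrame hm (MvPowerSeries.X 1 + MvPowerSeries.X 0) (MvPowerSeries.X 0 * MvPowerSeries.X 1)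
    (fun w => (MvPowerSeries.commute_X w 1).symm.add_left (MvPowerSeries.commute_X w 0).symm)
    (fun w => (MvPowerSeries.commute_X w 0).symm.mul_left (MvPowerSeries.commute_X w 1).symm)

theorem rMat'_eq_refl {m : ℕ} (hm : 2 * m ≤ N) (A : Type*) [Ring A] :
    rMat' N A = (quatFrame hm A).refl := by
  set F := quatFrame hm A
  have hgg : F.g * F.g = 1 := antiDiag_mul_self
  have h : rMat' N A = F.l₁ F.g * (F.z - F.w * F.p) * F.l₁ F.g := by
    simp only [F, matFrame, rMat', smul_mul_assoc, one_mul]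
    rfl
  rw [h, LegFrame.refl, mul_sub, sub_mul, ← (F.z_comm _).eq, mul_assoc, ← map_mul, hgg, map_one,
    mul_one, (F.w_comm _).symm.left_comm, mul_assoc F.w, mul_assoc (F.l₁ F.g), F.p_l₁, mul_assoc]

theorem commute_smul_of_central {R n : Type*} [Ring R] [Fintype n] {a : R}
    (ha : ∀ w, Commute a w) {P M : Matrix n n R} (h : Commute P M) : Commute (a • P) M := by
  classical
  rw [← one_mul P, ← smul_mul_assoc]
  exact (commute_smul_one ha M).mul_left h

/-- The Yang matrix commutes with `M ⊗ M` if `M` has central entries. -/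
theorem rMat_commute {m : ℕ} (hm : 2 * m ≤ N) {A : Type*} [Ring A]
    {M : Matrix (Fin N) (Fin N) (MvPowerSeries (Fin 2) A)} (hM : ∀ i j w, Commute (M i j) w) :
    Commute (rMat N A) ((quatFrame hm A).l₁ M * (quatFrame hm A).l₂ M) := by
  refine Commute.sub_left (commute_smul_one (fun w => ?_) _)
    (commute_smul_of_central (fun w => ?_) ?_)
  · exact (MvPowerSeries.commute_X w 1).symm.sub_left (MvPowerSeries.commute_X w 0).symm
  · exact (MvPowerSeries.commute_X w 0).symm.mul_left (MvPowerSeries.commute_X w 1).symm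
  · set F := quatFrame hm A
    change F.p * (F.l₁ M * F.l₂ M) = F.l₁ M * F.l₂ M * F.p
    rw [← mul_assoc, F.p_l₁, mul_assoc, F.p_l₂, ← mul_assoc]
    congr 1
    exact (legHom_commute hM M).symm.eq

theorem leg₁_eq {A : Type*} [Ring A] (s : Matrix (Fin N) (Fin N) (PowerSeries A)) :
    leg₁ s = legHom₁ N _ ((inVarHom A 0).mapMatrix s) := rfl

theorem leg₂_eq {A : Type*} [Ring A] (s : Matrix (Fin N) (Fin N) (PowerSeries A)) :
    leg₂ s = legHom₂ N _ ((inVarHom A 1).mapMatrix s) := rfl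

theorem map_indicatorMat {W W' : Type*} [Ring W] [Ring W'] (φ : W →+* W') (p : Fin N → Prop)
    [DecidablePred p] : φ.mapMatrix (indicatorMat N W p) = indicatorMat N W' p := by
  ext i j
  simp only [indicatorMat, RingHom.mapMatrix_apply, Matrix.map_apply, Matrix.diagonal_apply]
  split_ifs <;> simp

/-- The index `m + i`, which runs through the middle indices of `Fin N`. -/
def midIdx {N m : ℕ} (h : 2 * m ≤ N) (i : Fin (N - 2 * m)) : Fin N := ⟨m + i, by omega⟩

theorem midIdx_injective {m : ℕ} (h : 2 * m ≤ N) : Function.Injective (midIdx h) := by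
  intro i j hij
  simpa [midIdx, Fin.ext_iff] using hij

theorem rev_midIdx {m : ℕ} (h : 2 * m ≤ N) (i : Fin (N - 2 * m)) :
    (midIdx h i).rev = midIdx h i.rev := by
  ext; simp [midIdx]; omega

theorem exists_midIdx {m : ℕ} (h : 2 * m ≤ N) {i : Fin N} (hi : m ≤ i ∧ i + m < N) :
    ∃ j, midIdx h j = i := ⟨⟨i - m, by omega⟩, by ext; simp [midIdx]; omega⟩

/-- The restriction of a matrix on the tensor square to the middle indices on both legs. -/
def compress {m : ℕ} (h : 2 * m ≤ N) {W : Type*} (M : Matrix (Fin N × Fin N) (Fin N × Fin N) W) :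
    Matrix (Fin (N - 2 * m) × Fin (N - 2 * m)) (Fin (N - 2 * m) × Fin (N - 2 * m)) W :=
  M.submatrix (Prod.map (midIdx h) (midIdx h)) (Prod.map (midIdx h) (midIdx h))

/-- Restriction to the middle indices is multiplicative if the idempotent of the middle stands
between the factors. -/
theorem compress_mul {m : ℕ} (h : 2 * m ≤ N)
    (M M' : Matrix (Fin N × Fin N) (Fin N × Fin N) W) :
    compress h (M * (legHom₁ N W (midMat N m W) * legHom₂ N W (midMat N m W)) * M') =
      compress h M * compress h M' := by
  have hE : legHom₁ N W (midMat N m W) * legHom₂ N W (midMat N m W) =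
      Matrix.diagonal fun a : Fin N × Fin N =>
        if (m ≤ a.1 ∧ a.1 + m < N) ∧ (m ≤ a.2 ∧ a.2 + m < N) then 1 else 0 := by
    ext a b
    rw [legHom₁_mul_legHom₂]
    simp only [midMat, indicatorMat, Matrix.diagonal_apply, Prod.ext_iff]
    by_cases h₁ : a.1 = b.1 <;> by_cases h₂ : a.2 = b.2 <;> simp [h₁, h₂, ite_and]
    split_ifs <;> rfl
  ext a b
  rw [hE, Matrix.mul_apply, compress, Matrix.submatrix_apply, Matrix.mul_apply]
  symm
  apply Fintype.sum_of_injective (Prod.map (midIdx h) (midIdx h))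
    ((midIdx_injective h).prodMap (midIdx_injective h))
  · intro c hc
    rw [Matrix.mul_diagonal, if_neg, mul_zero, zero_mul]
    rintro ⟨h₁, h₂⟩
    obtain ⟨j, hj⟩ := exists_midIdx h h₁
    obtain ⟨k, hk⟩ := exists_midIdx h h₂
    exact hc ⟨(j, k), Prod.ext hj hk⟩
  · intro c
    rw [Matrix.mul_diagonal, if_pos, mul_one]
    · rfl
    · simp only [Prod.map_fst, Prod.map_snd, midIdx]
      omega

theorem compress_rMat {m : ℕ} (h : 2 * m ≤ N) (A : Type*) [Ring A] :
    compress h (rMat N A) = rMat (N - 2 * m) A := by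
  have hi := (midIdx_injective h).prodMap (midIdx_injective h)
  ext1 a b
  simp only [compress, rMat, Matrix.submatrix_apply, Matrix.sub_apply, Matrix.smul_apply,
    swapMat_apply, Matrix.one_apply, hi.eq_iff]
  have : (Prod.map (midIdx h) (midIdx h) a).swap = Prod.map (midIdx h) (midIdx h) a.swap := rfl
  rw [this]
  simp only [hi.eq_iff]

theorem rMat'_apply (A : Type*) [Ring A] (a b : Fin N × Fin N) :
    rMat' N A a b =
      (MvPowerSeries.X 1 + MvPowerSeries.X 0) * (if a = b then 1 else 0) -
      (MvPowerSeries.X 0 * MvPowerSeries.X 1) *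
        (if a.1.rev = b.2 ∧ a.2 = b.1.rev then 1 else 0) := by
  have h : rMat' N A = (MvPowerSeries.X 1 + MvPowerSeries.X 0 : MvPowerSeries (Fin 2) A) • 1 -
      ((MvPowerSeries.X 0 * MvPowerSeries.X 1 : MvPowerSeries (Fin 2) A) • 1) *
        (legHom₁ N _ (antiDiag N _) * legHom₂ N _ (antiDiag N _) * swapMat N _) :=
    rMat'_eq_refl (m := 0) (by omega) A
  rw [h, smul_mul_assoc, one_mul, mul_swapMat]
  simp only [Matrix.sub_apply, Matrix.smul_apply, Matrix.one_apply, Matrix.submatrix_apply,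
    legHom₁_mul_legHom₂, antiDiag, smul_eq_mul, Prod.fst_swap, Prod.snd_swap, id, Fin.rev_eq_iff,
    ite_and, mul_ite, mul_one, mul_zero]
  split_ifs <;> simp_all

theorem compress_rMat' {m : ℕ} (h : 2 * m ≤ N) (A : Type*) [Ring A] :
    compress h (rMat' N A) = rMat' (N - 2 * m) A := by
  have hi := (midIdx_injective h).prodMap (midIdx_injective h)
  ext1 a b
  simp only [compress, Matrix.submatrix_apply, rMat'_apply, hi.eq_iff, Prod.map_fst, Prod.map_snd,
    rev_midIdx, (midIdx_injective h).eq_iff]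

theorem compress_leg₁ {m : ℕ} (h : 2 * m ≤ N) {A : Type*} [Ring A]
    (s : Matrix (Fin N) (Fin N) (PowerSeries A)) :
    compress h (leg₁ s) = leg₁ (s.submatrix (midIdx h) (midIdx h)) := by
  ext1 a b
  simp only [leg₁_eq, compress, Matrix.submatrix_apply, legHom₁_apply, Prod.map_fst, Prod.map_snd,
    (midIdx_injective h).eq_iff]
  rfl

theorem compress_leg₂ {m : ℕ} (h : 2 * m ≤ N) {A : Type*} [Ring A]
    (s : Matrix (Fin N) (Fin N) (PowerSeries A)) :
    compress h (leg₂ s) = leg₂ (s.submatrix (midIdx h) (midIdx h)) := by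
  ext1 a b
  simp only [leg₂_eq, compress, Matrix.submatrix_apply, legHom₂_apply, Prod.map_fst, Prod.map_snd,
    (midIdx_injective h).eq_iff]
  rfl

/-- The middle block of the Schur complement inherits the quaternary relation. -/
theorem quat_schur {m : ℕ} (hm : 2 * m ≤ N) {A : Type*} [Ring A]
    {s α κ : Matrix (Fin N) (Fin N) (PowerSeries A)} (h : quatLHS s = quatRHS s)
    (hs : Pivot (midMat N m _) (topMat N m _) s α κ) :
    quatLHS ((schur (midMat N m _) s α).submatrix (midIdx hm) (midIdx hm)) =
      quatRHS ((schur (midMat N m _) s α).submatrix (midIdx hm) (midIdx hm)) := by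
  have h₀ := hs.map (inVarHom A 0).mapMatrix
  have h₁ := hs.map (inVarHom A 1).mapMatrix
  have hc₀ := map_schur (inVarHom A 0).mapMatrix (midMat N m _) s α
  have hc₁ := map_schur (inVarHom A 1).mapMatrix (midMat N m _) s α
  have hm₀ (a : Fin 2) : (inVarHom A a).mapMatrix (midMat N m _) = midMat N m _ :=
    map_indicatorMat _ _
  have hm₁ (a : Fin 2) : (inVarHom A a).mapMatrix (topMat N m _) = topMat N m _ :=
    map_indicatorMat _ _
  rw [hm₀] at hc₀ hc₁
  rw [hm₀, hm₁] at h₀ h₁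
  have key := LegFrame.schur_reflection_compressed (F := quatFrame hm A) h₀ h₁ (R := rMat N A)
    ?_ ?_ ?_ ?_
  · have := congrArg (compress hm) key
    rw [← rMat'_eq_refl] at this
    change compress hm (rMat N A *
      (legHom₁ N _ (midMat N m _) * legHom₂ N _ (midMat N m _)) *
      legHom₁ N _ (schur (midMat N m _) _ _) *
      (legHom₁ N _ (midMat N m _) * legHom₂ N _ (midMat N m _)) * rMat' N A *
      (legHom₁ N _ (midMat N m _) * legHom₂ N _ (midMat N m _)) *
      legHom₂ N _ (schur (midMat N m _) _ _)) =
      compress hm (legHom₂ N _ (schur (midMat N m _) _ _) *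
      (legHom₁ N _ (midMat N m _) * legHom₂ N _ (midMat N m _)) * rMat' N A *
      (legHom₁ N _ (midMat N m _) * legHom₂ N _ (midMat N m _)) *
      legHom₁ N _ (schur (midMat N m _) _ _) *
      (legHom₁ N _ (midMat N m _) * legHom₂ N _ (midMat N m _)) * rMat N A) at this
    rw [← hc₀, ← hc₁, ← leg₁_eq, ← leg₂_eq] at this
    rw [quatLHS, quatRHS]
    simpa only [compress_mul, compress_rMat, compress_rMat', compress_leg₁, compress_leg₂] using
      this
  · intro x hx
    ext1 a b
    have := congrFun (congrFun hx a) b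
    refine eq_zero_of_add_X_mul_eq_zero ?_
    simpa [matFrame] using this
  · refine rMat_commute hm fun i j w => ?_
    exact (indicatorMat_commute _ i j w).add_left (indicatorMat_commute _ i j w)
  · exact rMat_commute hm (indicatorMat_commute _)
  · rw [← rMat'_eq_refl]
    change rMat N A * (leg₁ s * rMat' N A * leg₂ s) = leg₂ s * rMat' N A * leg₁ s * rMat N A
    simpa only [quatLHS, quatRHS, mul_assoc] using h

end Legs

/-! ### Universal property -/

section Universal

variable {A B : Type*} [Ring A] [Ring B] {N : ℕ}

theorem serMatrix_apply (g : Fin N → Fin N → ℕ → A) (i j : Fin N) (r : ℕ) :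
    PowerSeries.coeff (r + 1) (serMatrix g i j) = g i j r := by
  simp [serMatrix]

theorem constantCoeff_serMatrix (g : Fin N → Fin N → ℕ → A) :
    (PowerSeries.constantCoeff (R := A)).mapMatrix (serMatrix g) = 1 := by
  ext i j
  simp [serMatrix, Matrix.one_apply]

/-- A matrix of power series with constant coefficient `1` has the shape `serMatrix g`. -/
theorem serMatrix_coeff {M : Matrix (Fin N) (Fin N) (PowerSeries A)}
    (hM : (PowerSeries.constantCoeff (R := A)).mapMatrix M = 1) :
    serMatrix (fun i j r => PowerSeries.coeff (r + 1) (M i j)) = M := by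
  ext i j r
  cases r with
  | zero =>
    have := congrFun (congrFun hM i) j
    simp only [RingHom.mapMatrix_apply, Matrix.map_apply, Matrix.one_apply] at this
    simp [serMatrix, this]
  | succ r => rw [serMatrix_apply]

theorem map_serMatrix (φ : A →+* B) (g : Fin N → Fin N → ℕ → A) (i j : Fin N) :
    PowerSeries.map φ (serMatrix g i j) = serMatrix (fun i j r => φ (g i j r)) i j := by
  ext r
  cases r with
  | zero => simp only [serMatrix, PowerSeries.coeff_map, PowerSeries.coeff_mk]; split_ifs <;> simp
  | succ r => simp [serMatrix]

theorem rMat_apply (a b : Fin N × Fin N) :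
    rMat N A a b =
      (MvPowerSeries.X 1 - MvPowerSeries.X 0) * (if a = b then 1 else 0) -
      (MvPowerSeries.X 0 * MvPowerSeries.X 1) * (if a.swap = b then 1 else 0) := by
  simp only [rMat, Matrix.sub_apply, Matrix.smul_apply, swapMat_apply, Matrix.one_apply,
    smul_eq_mul]

theorem map_rMat (φ : A →+* B) :
    (MvPowerSeries.map (σ := Fin 2) φ).mapMatrix (rMat N A) = rMat N B := by
  ext1 a b
  simp only [RingHom.mapMatrix_apply, Matrix.map_apply, rMat_apply]
  split_ifs <;> simp

theorem map_rMat' (φ : A →+* B) :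
    (MvPowerSeries.map (σ := Fin 2) φ).mapMatrix (rMat' N A) = rMat' N B := by
  ext1 a b
  simp only [RingHom.mapMatrix_apply, Matrix.map_apply, rMat'_apply]
  split_ifs <;> simp

theorem map_leg₁ (φ : A →+* B) (s : Matrix (Fin N) (Fin N) (PowerSeries A)) :
    (MvPowerSeries.map (σ := Fin 2) φ).mapMatrix (leg₁ s) = leg₁ (s.map (PowerSeries.map φ)) := by
  ext1 a b
  simp only [leg₁_eq, RingHom.mapMatrix_apply, Matrix.map_apply, legHom₁_apply, inVarHom_apply]
  split_ifs
  · exact map_inVar _ _ _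
  · exact map_zero _

theorem map_leg₂ (φ : A →+* B) (s : Matrix (Fin N) (Fin N) (PowerSeries A)) :
    (MvPowerSeries.map (σ := Fin 2) φ).mapMatrix (leg₂ s) = leg₂ (s.map (PowerSeries.map φ)) := by
  ext1 a b
  simp only [leg₂_eq, RingHom.mapMatrix_apply, Matrix.map_apply, legHom₂_apply, inVarHom_apply]
  split_ifs
  · exact map_inVar _ _ _
  · exact map_zero _

theorem map_quatLHS (φ : A →+* B) (s : Matrix (Fin N) (Fin N) (PowerSeries A)) :
    (MvPowerSeries.map (σ := Fin 2) φ).mapMatrix (quatLHS s) =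
      quatLHS (s.map (PowerSeries.map φ)) := by
  simp only [quatLHS, map_mul, map_rMat, map_rMat', map_leg₁, map_leg₂]

theorem map_quatRHS (φ : A →+* B) (s : Matrix (Fin N) (Fin N) (PowerSeries A)) :
    (MvPowerSeries.map (σ := Fin 2) φ).mapMatrix (quatRHS s) =
      quatRHS (s.map (PowerSeries.map φ)) := by
  simp only [quatRHS, map_mul, map_rMat, map_rMat', map_leg₁, map_leg₂]

theorem map_freeS {C : Type*} [Ring C] [Algebra ℂ C] (φ : FreeGen N →ₐ[ℂ] C) :
    (freeS N).map (PowerSeries.map (φ : FreeGen N →+* C)) =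
      serMatrix fun i j r => φ (FreeAlgebra.ι ℂ (i, j, r)) :=
  Matrix.ext fun i j => map_serMatrix _ _ i j

theorem quatLHS_S (N : ℕ) : quatLHS (S N) = quatRHS (S N) := by
  have h : S N = (freeS N).map (PowerSeries.map
      (RingQuot.mkAlgHom ℂ (QuaternaryRel N) : FreeGen N →+* ExtTwistedYangian N)) :=
    (map_freeS _).symm
  rw [h, ← map_quatLHS, ← map_quatRHS]
  ext p q d
  simp only [RingHom.mapMatrix_apply, Matrix.map_apply, MvPowerSeries.coeff_map]
  exact RingQuot.mkAlgHom_rel ℂ (.quaternary p q d)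

/-- Every matrix of power series over an algebra that has constant coefficient `1` and satisfies the
quaternary relation is the image of `S(u)` under a homomorphism. -/
theorem exists_algHom_of_quat {C : Type*} [Ring C] [Algebra ℂ C]
    {M : Matrix (Fin N) (Fin N) (PowerSeries C)}
    (hM : (PowerSeries.constantCoeff (R := C)).mapMatrix M = 1) (h : quatLHS M = quatRHS M) :
    ∃ φ : ExtTwistedYangian N →ₐ[ℂ] C, ∀ i j,
      PowerSeries.map (φ : ExtTwistedYangian N →+* C) (S N i j) = M i j := by
  let f : FreeGen N →ₐ[ℂ] C :=
    FreeAlgebra.lift ℂ fun x => PowerSeries.coeff (x.2.2 + 1) (M x.1 x.2.1)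
  have hf : (freeS N).map (PowerSeries.map (f : FreeGen N →+* C)) = M := by
    rw [map_freeS]
    simp only [f, FreeAlgebra.lift_ι_apply]
    exact serMatrix_coeff hM
  have hrel : ∀ ⦃x y⦄, QuaternaryRel N x y → f x = f y := by
    rintro _ _ ⟨p, q, d⟩
    have h' : (MvPowerSeries.map (σ := Fin 2) (f : FreeGen N →+* C)).mapMatrix (quatLHS (freeS N)) =
        (MvPowerSeries.map (σ := Fin 2) (f : FreeGen N →+* C)).mapMatrix (quatRHS (freeS N)) := by
      rw [map_quatLHS, map_quatRHS, hf, h]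
    have := congrArg (MvPowerSeries.coeff d) (congrFun (congrFun h' p) q)
    simp only [RingHom.mapMatrix_apply, Matrix.map_apply, MvPowerSeries.coeff_map] at this
    exact this
  refine ⟨RingQuot.liftAlgHom ℂ ⟨f, hrel⟩, fun i j => ?_⟩
  rw [S, map_serMatrix]
  conv_rhs => rw [← hf, map_freeS]
  congr 1
  ext i j r
  exact RingQuot.liftAlgHom_mkAlgHom_apply ℂ f hrel _

theorem algHom_ext_of_map_S {C : Type*} [Ring C] [Algebra ℂ C]
    {φ ψ : ExtTwistedYangian N →ₐ[ℂ] C}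
    (h : ∀ i j, PowerSeries.map (φ : ExtTwistedYangian N →+* C) (S N i j) =
      PowerSeries.map (ψ : ExtTwistedYangian N →+* C) (S N i j)) : φ = ψ := by
  apply RingQuot.ringQuot_ext'
  apply FreeAlgebra.hom_ext
  ext ⟨i, j, r⟩
  have := congrArg (PowerSeries.coeff (r + 1)) (h i j)
  simp only [PowerSeries.coeff_map, S, serMatrix_apply] at this
  exact this

end Universal

/-! ### Quasideterminants as Schur complements -/

section Quasidet

theorem leadingMinor_borderBlock {N M m : ℕ} (h : m + M ≤ N) (i j : Fin M) :
    leadingMinor (borderBlock h i j) =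
      (S N).submatrix (Fin.castLE (by omega)) (Fin.castLE (by omega : m ≤ N)) := by
  ext1 k l
  simp [leadingMinor, borderBlock, borderIdx]

variable {R : Type*} [Ring R] {N m : ℕ}

theorem sum_castLE (hm : m ≤ N) (f : Fin N → R) (hf : ∀ i : Fin N, m ≤ i → f i = 0) :
    ∑ k : Fin m, f (Fin.castLE hm k) = ∑ i, f i := by
  apply Fintype.sum_of_injective (Fin.castLE hm) (Fin.castLE_injective hm)
  · intro i hi
    apply hf
    by_contra hlt
    exact hi ⟨⟨i, by omega⟩, rfl⟩
  · intro i; rfl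

variable {s α κ : Matrix (Fin N) (Fin N) R}

theorem Pivot.apply_eq_zero_left {e₀ : Matrix (Fin N) (Fin N) R}
    (h : Pivot e₀ (topMat N m R) s α κ) {i : Fin N} (hi : m ≤ i) (j : Fin N) : α i j = 0 := by
  rw [← h.e₁_mul, topMat, indicatorMat, Matrix.diagonal_mul, if_neg (by omega), zero_mul]

theorem Pivot.apply_eq_zero_right {e₀ : Matrix (Fin N) (Fin N) R}
    (h : Pivot e₀ (topMat N m R) s α κ) {j : Fin N} (hj : m ≤ j) (i : Fin N) : α i j = 0 := by
  rw [← h.mul_e₁, topMat, indicatorMat, Matrix.mul_diagonal, if_neg (by omega), mul_zero]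

theorem Pivot.submatrix_mul {e₀ : Matrix (Fin N) (Fin N) R}
    (h : Pivot e₀ (topMat N m R) s α κ) (hm : m ≤ N) :
    s.submatrix (Fin.castLE hm) (Fin.castLE hm) * α.submatrix (Fin.castLE hm) (Fin.castLE hm) =
      1 := by
  ext1 i j
  have := congrFun (congrFun h.right_inv (Fin.castLE hm i)) (Fin.castLE hm j)
  rw [mul_assoc, topMat, indicatorMat, Matrix.diagonal_mul, if_pos (by simp), one_mul,
    Matrix.diagonal_apply] at this
  rw [Matrix.mul_apply] at this ⊢
  simp only [Matrix.submatrix_apply]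
  rw [sum_castLE hm (fun k => s (Fin.castLE hm i) k * α k (Fin.castLE hm j)), this]
  · simp [Matrix.one_apply]
  · intro k hk; rw [h.apply_eq_zero_left hk, mul_zero]

theorem Pivot.mul_submatrix {e₀ : Matrix (Fin N) (Fin N) R}
    (h : Pivot e₀ (topMat N m R) s α κ) (hm : m ≤ N) :
    α.submatrix (Fin.castLE hm) (Fin.castLE hm) * s.submatrix (Fin.castLE hm) (Fin.castLE hm) =
      1 := by
  ext1 i j
  have := congrFun (congrFun h.left_inv (Fin.castLE hm i)) (Fin.castLE hm j)
  rw [topMat, indicatorMat, Matrix.mul_diagonal, if_pos (by simp), mul_one,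
    Matrix.diagonal_apply] at this
  rw [Matrix.mul_apply] at this ⊢
  simp only [Matrix.submatrix_apply]
  rw [sum_castLE hm (fun k => α (Fin.castLE hm i) k * s k (Fin.castLE hm j)), this]
  · simp [Matrix.one_apply]
  · intro k hk; rw [h.apply_eq_zero_right hk, zero_mul]

theorem Pivot.isUnit_submatrix {e₀ : Matrix (Fin N) (Fin N) R}
    (h : Pivot e₀ (topMat N m R) s α κ) (hm : m ≤ N) :
    IsUnit (s.submatrix (Fin.castLE hm) (Fin.castLE hm)) :=
  ⟨⟨_, _, h.submatrix_mul hm, h.mul_submatrix hm⟩, rfl⟩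

theorem Pivot.inverse_submatrix {e₀ : Matrix (Fin N) (Fin N) R}
    (h : Pivot e₀ (topMat N m R) s α κ) (hm : m ≤ N) :
    Ring.inverse (s.submatrix (Fin.castLE hm) (Fin.castLE hm)) =
      α.submatrix (Fin.castLE hm) (Fin.castLE hm) :=
  Ring.inverse_unit (⟨_, _, h.submatrix_mul hm, h.mul_submatrix hm⟩ : (Matrix (Fin m) (Fin m) R)ˣ)

theorem schur_midMat_apply (s α : Matrix (Fin N) (Fin N) R) {i j : Fin N} (hi : m ≤ i ∧ i + m < N)
    (hj : m ≤ j ∧ j + m < N) :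
    schur (midMat N m R) s α i j = s i j - ∑ k, ∑ l, s i k * α k l * s l j := by
  have h (M : Matrix (Fin N) (Fin N) R) : (midMat N m R * M * midMat N m R) i j = M i j := by
    rw [midMat, indicatorMat, Matrix.mul_diagonal, Matrix.diagonal_mul, if_pos hi, if_pos hj,
      one_mul, mul_one]
  have h' : schur (midMat N m R) s α =
      midMat N m R * (s - s * α * s) * midMat N m R := by
    rw [schur]; noncomm_ring
  rw [h', h, Matrix.sub_apply, Matrix.mul_apply]
  simp only [Matrix.mul_apply, Finset.sum_mul]
  rw [Finset.sum_comm]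

end Quasidet

theorem quasidet_borderBlock {N m : ℕ} (hm : 2 * m + 1 ≤ N)
    {e₀ α κ : Matrix (Fin N) (Fin N) (PowerSeries (ExtTwistedYangian N))}
    (h : Pivot e₀ (topMat N m _) (S N) α κ) (i j : Fin (N - 2 * m)) :
    quasidet (borderBlock (shift_le hm) i j) =
      schur (midMat N m _) (S N) α (midIdx (by omega) i) (midIdx (by omega) j) := by
  have hmN : m ≤ N := by omega
  rw [schur_midMat_apply _ _ (by simp only [midIdx]; omega) (by simp only [midIdx]; omega),
    quasidet, leadingMinor_borderBlock, h.inverse_submatrix]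
  have hl (a b : Fin (N - 2 * m)) : borderBlock (shift_le hm) a b (Fin.last m) (Fin.last m) =
      S N (midIdx (by omega) a) (midIdx (by omega) b) := by
    simp [borderBlock, borderIdx, shiftIdx, midIdx]
  have hr (k : Fin m) : borderBlock (shift_le hm) i j (Fin.last m) k.castSucc =
      S N (midIdx (by omega) i) (Fin.castLE hmN k) := by
    simp [borderBlock, borderIdx, shiftIdx, midIdx]
  have hc (l : Fin m) : borderBlock (shift_le hm) i j l.castSucc (Fin.last m) =
      S N (Fin.castLE hmN l) (midIdx (by omega) j) := by
    simp [borderBlock, borderIdx, shiftIdx, midIdx]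
  simp only [hl, hr, hc, Matrix.submatrix_apply]
  congr 1
  rw [← sum_castLE hmN]
  · refine Finset.sum_congr rfl fun k _ => ?_
    rw [← sum_castLE hmN]
    intro l hl
    rw [h.apply_eq_zero_right hl, mul_zero, zero_mul]
  · intro k hk
    refine Finset.sum_eq_zero fun l _ => ?_
    rw [h.apply_eq_zero_left hk, mul_zero, zero_mul]

/-- The leading block of `S(u)` is invertible, and the shift homomorphism from rank `N - 2 m` exists
and is unique. -/
theorem existsUnique_isShiftHom {N m : ℕ} (hm : 2 * m + 1 ≤ N) :
    (∀ i j : Fin (N - 2 * m), IsUnit (leadingMinor (borderBlock (shift_le hm) i j))) ∧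
      ∃! ψ : ExtTwistedYangian (N - 2 * m) →ₐ[ℂ] ExtTwistedYangian N,
        IsShiftHom (shift_le hm) ψ := by
  let ε : Matrix (Fin N) (Fin N) (PowerSeries (ExtTwistedYangian N)) →+*
    Matrix (Fin N) (Fin N) (ExtTwistedYangian N) := PowerSeries.constantCoeff.mapMatrix
  have hS : ε (S N) = 1 := constantCoeff_serMatrix _
  obtain ⟨α, κ, h, hε⟩ := exists_pivot ε
    (fun k hk => isUnit_of_map_constantCoeff_eq_one hk) (midMat_mul_self m) (topMat_mul_self m)
    (topMat_mul_midMat m) hS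
  have hmN : 2 * m ≤ N := by omega
  refine ⟨fun i j => ?_, ?_⟩
  · rw [leadingMinor_borderBlock]
    exact h.isUnit_submatrix _
  · have hc : (PowerSeries.constantCoeff (R := ExtTwistedYangian N)).mapMatrix
        ((schur (midMat N m _) (S N) α).submatrix (midIdx hmN) (midIdx hmN)) = 1 := by
      ext1 i j
      have := congrFun (congrFun hε (midIdx hmN i)) (midIdx hmN j)
      simp only [ε, RingHom.mapMatrix_apply, Matrix.map_apply, Matrix.submatrix_apply] at this ⊢
      rw [this, midMat, indicatorMat, Matrix.diagonal_apply]
      simp only [(midIdx_injective hmN).eq_iff, Matrix.one_apply]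
      split_ifs with h1 h2
      · simp
      · simp only [midIdx] at h2; omega
      · simp
    obtain ⟨φ, hφ⟩ := exists_algHom_of_quat hc (quat_schur hmN (quatLHS_S N) h)
    refine ⟨φ, fun i j => ?_, fun ψ hψ => algHom_ext_of_map_S fun i j => ?_⟩
    · rw [hφ, quasidet_borderBlock hm h]; rfl
    · rw [hφ, hψ i j, quasidet_borderBlock hm h]; rfl

/-! ### The coefficients of `u⁻¹` on the diagonal -/

section FirstCoeff
variable {A : Type*} [Ring A] {N : ℕ}

/-- The exponent of the monomial `X₀ ^ p X₁ ^ q`. -/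
def bideg (p q : ℕ) : Fin 2 →₀ ℕ := Finsupp.single 0 p + Finsupp.single 1 q

theorem coeff_bideg_inVar (f g : PowerSeries A) (p q : ℕ) :
    MvPowerSeries.coeff (bideg p q) (inVar 0 f * inVar 1 g) =
      PowerSeries.coeff p f * PowerSeries.coeff q g := by
  rw [coeff_inVar_mul_inVar (by decide)]
  simp [bideg]

theorem coeff_bideg_inVar' (f g : PowerSeries A) (p q : ℕ) :
    MvPowerSeries.coeff (bideg p q) (inVar 1 g * inVar 0 f) =
      PowerSeries.coeff q g * PowerSeries.coeff p f := by
  rw [coeff_inVar_mul_inVar (by decide)]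
  simp [bideg]

theorem coeff_bideg_X_zero_mul (f : MvPowerSeries (Fin 2) A) (p q : ℕ) :
    MvPowerSeries.coeff (bideg (p + 1) q) (MvPowerSeries.X 0 * f) =
      MvPowerSeries.coeff (bideg p q) f := by
  have : bideg (p + 1) q = Finsupp.single 0 1 + bideg p q := by
    rw [bideg, bideg, add_comm p, Finsupp.single_add, add_assoc]
  rw [this, MvPowerSeries.X_def, MvPowerSeries.coeff_add_monomial_mul, one_mul]

theorem coeff_bideg_zero_X_zero_mul (f : MvPowerSeries (Fin 2) A) (q : ℕ) :
    MvPowerSeries.coeff (bideg 0 q) (MvPowerSeries.X 0 * f) = 0 := by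
  classical
  rw [MvPowerSeries.X_def, MvPowerSeries.coeff_monomial_mul, if_neg]
  intro h
  simpa [bideg] using h 0

theorem coeff_bideg_X_one_mul (f : MvPowerSeries (Fin 2) A) (p q : ℕ) :
    MvPowerSeries.coeff (bideg p (q + 1)) (MvPowerSeries.X 1 * f) =
      MvPowerSeries.coeff (bideg p q) f := by
  have : bideg p (q + 1) = Finsupp.single 1 1 + bideg p q := by
    rw [bideg, bideg, add_comm q, Finsupp.single_add, add_left_comm]
  rw [this, MvPowerSeries.X_def, MvPowerSeries.coeff_add_monomial_mul, one_mul]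

theorem rMat_mul_apply (Z : Matrix (Fin N × Fin N) (Fin N × Fin N) (MvPowerSeries (Fin 2) A))
    (a b : Fin N × Fin N) :
    (rMat N A * Z) a b = (MvPowerSeries.X 1 - MvPowerSeries.X 0) * Z a b -
      (MvPowerSeries.X 0 * MvPowerSeries.X 1) * Z a.swap b := by
  rw [rMat, sub_mul, smul_mul_assoc, smul_mul_assoc, one_mul, swapMat_mul]
  rfl

theorem mul_rMat_apply (Z : Matrix (Fin N × Fin N) (Fin N × Fin N) (MvPowerSeries (Fin 2) A))
    (a b : Fin N × Fin N) :
    (Z * rMat N A) a b = (MvPowerSeries.X 1 - MvPowerSeries.X 0) * Z a b -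
      (MvPowerSeries.X 0 * MvPowerSeries.X 1) * Z a b.swap := by
  have h₁ (w : MvPowerSeries (Fin 2) A) :
      Commute (MvPowerSeries.X 1 - MvPowerSeries.X 0 : MvPowerSeries (Fin 2) A) w :=
    (MvPowerSeries.commute_X w 1).symm.sub_left (MvPowerSeries.commute_X w 0).symm
  have h₂ (w : MvPowerSeries (Fin 2) A) :
      Commute (MvPowerSeries.X 0 * MvPowerSeries.X 1 : MvPowerSeries (Fin 2) A) w :=
    (MvPowerSeries.commute_X w 0).symm.mul_left (MvPowerSeries.commute_X w 1).symm
  have h : rMat N A = (MvPowerSeries.X 1 - MvPowerSeries.X 0 : MvPowerSeries (Fin 2) A) • 1 -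
      ((MvPowerSeries.X 0 * MvPowerSeries.X 1 : MvPowerSeries (Fin 2) A) • 1) * swapMat N _ := by
    rw [rMat, smul_mul_assoc, one_mul]
  rw [h, mul_sub, ← (commute_smul_one h₁ Z).eq, ← mul_assoc, ← (commute_smul_one h₂ Z).eq,
    mul_swapMat, smul_mul_assoc, smul_mul_assoc, one_mul]
  rfl

/-- A reflection product with the flip moved to the right. -/
theorem LegFrame.l₁_refl_l₂ {K L : Type*} [Ring K] [Ring L] (F : LegFrame K L) (s t : K) :
    F.l₁ s * F.refl * F.l₂ t =
      F.z * (F.l₁ s * F.l₂ t) - F.w * (F.l₁ (s * F.g * t) * F.l₂ F.g * F.p) := by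
  have h₁ : F.l₁ s * F.z * F.l₂ t = F.z * (F.l₁ s * F.l₂ t) := by
    rw [← (F.z_comm _).eq, mul_assoc]
  have h₂ : F.l₁ s * (F.w * (F.l₁ F.g * F.l₂ F.g * F.p)) * F.l₂ t =
      F.w * (F.l₁ (s * F.g * t) * F.l₂ F.g * F.p) := by
    rw [(F.w_comm _).symm.left_comm]
    simp only [mul_assoc, F.p_l₂, map_mul, (F.g_comm' t).left_comm]
  rw [LegFrame.refl, mul_sub, sub_mul, h₁, h₂]

theorem leg₁_rMat'_leg₂_apply (s : Matrix (Fin N) (Fin N) (PowerSeries A)) (j : Fin N) :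
    (leg₁ s * rMat' N A * leg₂ s) (j.rev, j.rev) (j, j) =
      (MvPowerSeries.X 1 + MvPowerSeries.X 0) * (inVar 0 (s j.rev j) * inVar 1 (s j.rev j)) -
      (MvPowerSeries.X 0 * MvPowerSeries.X 1) *
        ∑ e : Fin N, inVar 0 (s j.rev e.rev) * inVar 1 (s e j) := by
  have h := (quatFrame (m := 0) (Nat.zero_le N) A).l₁_refl_l₂ ((inVarHom A 0).mapMatrix s)
    ((inVarHom A 1).mapMatrix s)
  rw [← rMat'_eq_refl] at h
  simp only [matFrame, mul_antiDiag, mul_swapMat, smul_mul_assoc, one_mul] at h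
  rw [leg₁_eq, leg₂_eq, h]
  simp only [Matrix.sub_apply, Matrix.smul_apply, Matrix.submatrix_apply, legHom₁_mul_legHom₂]
  simp only [Prod.swap_prod_mk, smul_eq_mul, Matrix.mul_apply, Matrix.submatrix_apply,
    RingHom.mapMatrix_apply, Matrix.map_apply, inVarHom_apply, antiDiag, id, if_true, mul_one]

theorem leg₂_rMat'_leg₁_apply (s : Matrix (Fin N) (Fin N) (PowerSeries A)) (j : Fin N) :
    (leg₂ s * rMat' N A * leg₁ s) (j.rev, j.rev) (j, j) =
      (MvPowerSeries.X 1 + MvPowerSeries.X 0) * (inVar 1 (s j.rev j) * inVar 0 (s j.rev j)) -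
      (MvPowerSeries.X 0 * MvPowerSeries.X 1) *
        ∑ e : Fin N, inVar 1 (s j.rev e.rev) * inVar 0 (s e j) := by
  have h := (quatFrame (m := 0) (Nat.zero_le N) A).swap.l₁_refl_l₂ ((inVarHom A 1).mapMatrix s)
    ((inVarHom A 0).mapMatrix s)
  rw [LegFrame.swap_refl, ← rMat'_eq_refl] at h
  simp only [LegFrame.swap, matFrame, mul_antiDiag, mul_swapMat, smul_mul_assoc, one_mul] at h
  rw [leg₁_eq, leg₂_eq, h]
  simp only [Matrix.sub_apply, Matrix.smul_apply, Matrix.submatrix_apply, legHom₂_mul_legHom₁]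
  simp only [Prod.swap_prod_mk, smul_eq_mul, Matrix.mul_apply, Matrix.submatrix_apply,
    RingHom.mapMatrix_apply, Matrix.map_apply, inVarHom_apply, antiDiag, id, if_true, mul_one]

/-- The quaternary relation makes the coefficient of `u⁻¹` in `s_{jj}(u)` invariant under
`j ↦ N + 1 - j`. -/
theorem coeff_one_rev_eq {s : Matrix (Fin N) (Fin N) (PowerSeries A)}
    (hs : (PowerSeries.constantCoeff (R := A)).mapMatrix s = 1) (h : quatLHS s = quatRHS s)
    (j : Fin N) : PowerSeries.coeff 1 (s j j) = PowerSeries.coeff 1 (s j.rev j.rev) := by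
  by_cases hj : j.rev = j
  · rw [hj]
  have hc (k l : Fin N) : PowerSeries.coeff 0 (s k l) = if k = l then 1 else 0 := by
    rw [← Matrix.one_apply, ← hs]; simp
  -- The coefficient of `u⁻¹ v⁻³` in this entry contains the square of the coefficient of `u⁻¹` in
  -- `s j.rev j` on both sides; otherwise it only sees the sum over `e` in the two reflection
  -- products, in which the constant term of the factor in `u` leaves `e = j`.
  have key := congrFun (congrFun h (j.rev, j.rev)) (j, j)
  rw [quatLHS, quatRHS, mul_assoc, mul_assoc, rMat_mul_apply, mul_rMat_apply, ← mul_assoc,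
    Prod.swap_prod_mk, Prod.swap_prod_mk, leg₁_rMat'_leg₂_apply,
    leg₂_rMat'_leg₁_apply] at key
  have := congrArg (MvPowerSeries.coeff (bideg 1 3)) key
  simp only [sub_mul, add_mul, mul_assoc, mul_sub, mul_add, map_sub, map_add,
    coeff_bideg_X_zero_mul _ 0, coeff_bideg_X_one_mul _ _ 2, coeff_bideg_X_one_mul _ _ 1,
    coeff_bideg_zero_X_zero_mul, coeff_bideg_inVar, coeff_bideg_inVar', map_sum, hc, hj,
    if_false] at this
  simpa [Fin.rev_inj] using this

end FirstCoeff

/-! ### The vector representation -/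

section Rep

/-- The relations of the three transpositions `p = (1 2)`, `a = (1 3)`, `b = (2 3)` in the symmetric
group on three letters. -/
structure FlipTriple {L : Type*} [Ring L] (p a b : L) : Prop where
  pp : p * p = 1
  aa : a * a = 1
  bb : b * b = 1
  pa : p * a = a * b
  bp : b * p = a * b
  pb : p * b = b * a
  ap : a * p = b * a

variable {L : Type*} [Ring L] {p a b x y : L}

/-- The Yang–Baxter equation for the rational `R`-matrix, with denominators cleared; `x` and `y`
stand for the inverse spectral parameters. -/
theorem FlipTriple.yangBaxter (h : FlipTriple p a b) (hx : ∀ w, Commute x w)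
    (hy : ∀ w, Commute y w) :
    ((y - x) - x * y * p) * ((1 - x * a) * (1 - y * b)) =
      (1 - y * b) * (1 - x * a) * ((y - x) - x * y * p) := by
  have ha (w : L) : a * (x * w) = x * (a * w) := (hx a).symm.left_comm w
  have hb (w : L) : b * (x * w) = x * (b * w) := (hx b).symm.left_comm w
  have hp (w : L) : p * (x * w) = x * (p * w) := (hx p).symm.left_comm w
  have ha' (w : L) : a * (y * w) = y * (a * w) := (hy a).symm.left_comm w
  have hb' (w : L) : b * (y * w) = y * (b * w) := (hy b).symm.left_comm w
  have hp' (w : L) : p * (y * w) = y * (p * w) := (hy p).symm.left_comm w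
  have hyx (w : L) : y * (x * w) = x * (y * w) := (hx y).symm.left_comm w
  have h₁ : a * x = x * a := (hx a).symm.eq
  have h₂ : b * x = x * b := (hx b).symm.eq
  have h₃ : a * y = y * a := (hy a).symm.eq
  have h₄ : b * y = y * b := (hy b).symm.eq
  have hpab : p * (a * b) = a := by rw [← mul_assoc, h.pa, mul_assoc, h.bb, mul_one]
  have hbap : b * (b * a) = a := by rw [← mul_assoc, h.bb, one_mul]
  simp only [mul_sub, sub_mul, mul_assoc, mul_one, one_mul, ha, hb, hp, ha', hb', hp', hyx, h₁, h₂,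
    h₃, h₄, hpab, hbap, h.pa, h.bp, h.pb, h.ap]
  abel

/-- The form of the Yang–Baxter equation with the flip in the middle factor, whose spectral
parameter is the sum of the other two. -/
theorem FlipTriple.yangBaxter' (h : FlipTriple p a b) (hx : ∀ w, Commute x w)
    (hy : ∀ w, Commute y w) :
    (1 - x * a) * ((y + x) - x * y * p) * (1 - y * b) =
      (1 - y * b) * ((y + x) - x * y * p) * (1 - x * a) := by
  have ha (w : L) : a * (x * w) = x * (a * w) := (hx a).symm.left_comm w
  have hb (w : L) : b * (x * w) = x * (b * w) := (hx b).symm.left_comm w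
  have hp (w : L) : p * (x * w) = x * (p * w) := (hx p).symm.left_comm w
  have ha' (w : L) : a * (y * w) = y * (a * w) := (hy a).symm.left_comm w
  have hb' (w : L) : b * (y * w) = y * (b * w) := (hy b).symm.left_comm w
  have hp' (w : L) : p * (y * w) = y * (p * w) := (hy p).symm.left_comm w
  have hyx (w : L) : y * (x * w) = x * (y * w) := (hx y).symm.left_comm w
  have h₁ : a * x = x * a := (hx a).symm.eq
  have h₂ : b * x = x * b := (hx b).symm.eq
  have h₃ : a * y = y * a := (hy a).symm.eq
  have h₄ : b * y = y * b := (hy b).symm.eq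
  have hpab : a * (b * a) = p := by rw [← h.ap, ← mul_assoc, h.aa, one_mul]
  have hbap : b * (a * b) = p := by rw [← h.bp, ← mul_assoc, h.bb, one_mul]
  simp only [mul_add, add_mul, mul_sub, sub_mul, mul_assoc, mul_one, one_mul, ha, hb, hp, ha', hb',
    hp', hyx, h₁, h₂, h₃, h₄, hpab, hbap, h.pa, h.bp, h.pb, h.ap]
  abel

/-- The products `T G T G`, with `T = 1 - x a` on one leg and `T = 1 - y b` on the other, solve the
reflection equation. -/
theorem FlipTriple.reflection (h : FlipTriple p a b) (hx : ∀ w, Commute x w)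
    (hy : ∀ w, Commute y w) {g₁ g₂ : L} (h₁₁ : g₁ * g₁ = 1) (h₂₂ : g₂ * g₂ = 1)
    (h₁₂ : Commute g₁ g₂) (h₁b : Commute g₁ b) (h₂a : Commute g₂ a) (hp₁ : p * g₁ = g₂ * p)
    (hp₂ : p * g₂ = g₁ * p) :
    ((y - x) - x * y * p) * ((1 - x * a) * (g₁ * (1 - x * a) * g₁)) *
        (g₁ * ((y + x) - x * y * p) * g₁) * ((1 - y * b) * (g₂ * (1 - y * b) * g₂)) =
      (1 - y * b) * (g₂ * (1 - y * b) * g₂) * (g₁ * ((y + x) - x * y * p) * g₁) *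
        ((1 - x * a) * (g₁ * (1 - x * a) * g₁)) * ((y - x) - x * y * p) := by
  have hY := h.yangBaxter hx hy
  have hY' := h.yangBaxter' hx hy
  have hgp : g₁ * p * g₁ = g₂ * p * g₂ := by
    rw [mul_assoc, hp₁, mul_assoc, hp₂, ← mul_assoc, ← mul_assoc, h₁₂.eq]
  have hR' : g₁ * ((y + x) - x * y * p) * g₁ = g₂ * ((y + x) - x * y * p) * g₂ := by
    have e (g : L) (hg : g * g = 1) :
        g * ((y + x) - x * y * p) * g = (y + x) - x * y * (g * p * g) := by
      have h₀ : g * (y + x) * g = y + x := by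
        rw [((hy g).symm.add_right (hx g).symm).eq, mul_assoc, hg, mul_one]
      have h₁ : g * (x * y * p) = x * y * (g * p) :=
        (((hx g).symm.mul_right (hy g).symm)).left_comm p
      rw [mul_sub, sub_mul, h₀, h₁, mul_assoc (x * y)]
    rw [e g₁ h₁₁, e g₂ h₂₂, hgp]
  have hxy (w : L) : Commute (x * y) w := (hx w).mul_left (hy w)
  have hT₁ : Commute g₂ (1 - x * a) :=
    (Commute.one_right _).sub_right ((hx g₂).symm.mul_right h₂a)
  have hT₂ : Commute g₁ (1 - y * b) :=
    (Commute.one_right _).sub_right ((hy g₁).symm.mul_right h₁b)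
  have hgR : Commute (g₁ * g₂) ((y - x) - x * y * p) := by
    refine ((hy _).symm.sub_right (hx _).symm).sub_right ((hxy _).symm.mul_right ?_)
    rw [Commute, SemiconjBy, mul_assoc, ← hp₁, ← mul_assoc, ← hp₂, mul_assoc, h₁₂.eq]
  have hpR : Commute p ((y + x) - x * y * p) :=
    ((hy _).symm.add_right (hx _).symm).sub_right ((hxy _).symm.mul_right rfl)
  have hRR : Commute ((y - x) - x * y * p) (g₁ * ((y + x) - x * y * p) * g₁) := by
    refine ((hy _).sub_left (hx _)).sub_left ((hxy _).mul_left ?_)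
    calc p * (g₁ * ((y + x) - x * y * p) * g₁) = g₂ * (p * ((y + x) - x * y * p)) * g₁ := by
          rw [mul_assoc, ← mul_assoc p, hp₁]; simp only [mul_assoc]
      _ = g₂ * ((y + x) - x * y * p) * g₂ * p := by
          rw [hpR.eq, mul_assoc, mul_assoc _ p, hp₁]; simp only [mul_assoc]
      _ = _ := by rw [hR']
  generalize hT : 1 - x * a = T at *
  generalize hU : 1 - y * b = U at *
  generalize (y - x) - x * y * p = R at *
  generalize (y + x) - x * y * p = R₀ at *
  have c₁ (w : L) : g₁ * (g₁ * w) = w := by rw [← mul_assoc, h₁₁, one_mul]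
  have c₂ (w : L) : g₂ * (g₂ * w) = w := by rw [← mul_assoc, h₂₂, one_mul]
  -- conjugates of the two Yang–Baxter equations by `g₁`, `g₂` and `g₁ g₂`
  have hY₂ : g₁ * T * g₁ * (g₁ * R₀ * g₁) * U = U * (g₁ * R₀ * g₁) * (g₁ * T * g₁) := by
    calc _ = g₁ * (T * R₀ * U) * g₁ := by
          simp only [mul_assoc, c₁, hT₂.eq]
      _ = _ := by rw [hY']; simp only [mul_assoc, c₁, hT₂.left_comm]
  have hY₃ : T * (g₂ * R₀ * g₂) * (g₂ * U * g₂) = g₂ * U * g₂ * (g₂ * R₀ * g₂) * T := by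
    calc _ = g₂ * (T * R₀ * U) * g₂ := by
          simp only [mul_assoc, c₂, hT₁.left_comm]
      _ = _ := by rw [hY']; simp only [mul_assoc, c₂, hT₁.eq]
  have hY₄ : R * (g₁ * T * g₁ * (g₂ * U * g₂)) = g₂ * U * g₂ * (g₁ * T * g₁) * R := by
    have e₁ : g₁ * T * g₁ * (g₂ * U * g₂) = g₁ * g₂ * (T * U) * (g₁ * g₂) := by
      simp only [mul_assoc, hT₁.left_comm, hT₂.symm.left_comm, h₁₂.symm.left_comm]
    have e₂ : g₂ * U * g₂ * (g₁ * T * g₁) = g₁ * g₂ * (U * T) * (g₁ * g₂) := by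
      simp only [mul_assoc, hT₁.symm.left_comm, hT₂.left_comm, h₁₂.left_comm, h₁₂.eq]
    rw [e₁, e₂]
    generalize g₁ * g₂ = G at hgR ⊢
    calc R * (G * (T * U) * G) = G * (R * (T * U)) * G := by
          rw [← mul_assoc, ← mul_assoc, ← hgR.eq, mul_assoc G R]
      _ = G * (U * T) * G * R := by
          rw [hY, ← mul_assoc G, mul_assoc _ R, ← hgR.eq, ← mul_assoc]
  rw [← hR'] at hY₃
  calc _ = R * T * (g₁ * T * g₁ * (g₁ * R₀ * g₁) * U) * (g₂ * U * g₂) := by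
        simp only [mul_assoc]
    _ = R * (T * U) * (g₁ * R₀ * g₁) * (g₁ * T * g₁ * (g₂ * U * g₂)) := by
        rw [hY₂]; simp only [mul_assoc]
    _ = U * T * (g₁ * R₀ * g₁) * (R * (g₁ * T * g₁ * (g₂ * U * g₂))) := by
        rw [hY, mul_assoc (U * T), hRR.eq]; simp only [mul_assoc]
    _ = U * (T * (g₁ * R₀ * g₁) * (g₂ * U * g₂)) * (g₁ * T * g₁) * R := by
        rw [hY₄]; simp only [mul_assoc]
    _ = _ := by rw [hY₃]; simp only [mul_assoc]

/-- The flip of two copies of `ℂ^N`, written as a matrix of matrices: the entry in position `(i, j)`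
is the matrix unit `E_{ji}`. -/
def unitMat (N : ℕ) : Matrix (Fin N) (Fin N) (Matrix (Fin N) (Fin N) ℂ) :=
  .of fun i j => Matrix.single j i 1

/-- The image `T(u) G T(u) G` of `S(u)` in the vector representation, where `T(u) = 1 - u⁻¹ P` with
the flip `P` of `unitMat`. -/
def vectorS (N : ℕ) :
    Matrix (Fin N) (Fin N) (PowerSeries (Matrix (Fin N) (Fin N) ℂ)) :=
  (1 - (PowerSeries.X : PowerSeries (Matrix (Fin N) (Fin N) ℂ)) • (unitMat N).map PowerSeries.C) *
    (antiDiag N _ *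
      (1 - (PowerSeries.X : PowerSeries (Matrix (Fin N) (Fin N) ℂ)) •
        (unitMat N).map PowerSeries.C) * antiDiag N _)

theorem map_antiDiag {W W' : Type*} [Ring W] [Ring W'] (φ : W →+* W') (N : ℕ) :
    φ.mapMatrix (antiDiag N W) = antiDiag N W' := by
  ext i j
  simp only [antiDiag, RingHom.mapMatrix_apply, Matrix.map_apply]
  split_ifs <;> simp

theorem constantCoeff_vectorS (N : ℕ) :
    (PowerSeries.constantCoeff (R := Matrix (Fin N) (Fin N) ℂ)).mapMatrix (vectorS N) = 1 := by
  have h : (PowerSeries.constantCoeff (R := Matrix (Fin N) (Fin N) ℂ)).mapMatrix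
      ((PowerSeries.X : PowerSeries (Matrix (Fin N) (Fin N) ℂ)) •
        (unitMat N).map PowerSeries.C) = 0 := by
    ext1 i j
    simp
  rw [vectorS, map_mul, map_mul, map_mul, map_sub, map_one, h, map_antiDiag, sub_zero, one_mul,
    mul_one, antiDiag_mul_self]

theorem coeff_one_vectorS (N : ℕ) (i : Fin N) :
    PowerSeries.coeff 1 (vectorS N i i) =
      -(Matrix.single i i 1 + Matrix.single i.rev i.rev 1) := by
  have h : vectorS N = 1 - (PowerSeries.X : PowerSeries (Matrix (Fin N) (Fin N) ℂ)) •
      ((unitMat N).map PowerSeries.C +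
        ((unitMat N).map PowerSeries.C).submatrix Fin.rev Fin.rev) +
      (PowerSeries.X : PowerSeries (Matrix (Fin N) (Fin N) ℂ)) •
        ((unitMat N).map PowerSeries.C *
          ((PowerSeries.X : PowerSeries (Matrix (Fin N) (Fin N) ℂ)) •
            ((unitMat N).map PowerSeries.C).submatrix Fin.rev Fin.rev)) := by
    rw [vectorS, mul_sub, mul_one, sub_mul (antiDiag N _), antiDiag_mul_self, antiDiag_mul,
      mul_antiDiag]
    simp only [Matrix.submatrix_smul, Matrix.submatrix_submatrix, Pi.smul_apply]
    rw [sub_mul, one_mul, mul_sub, mul_one, smul_mul_assoc, smul_add]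
    change 1 - _ • Matrix.submatrix _ Fin.rev Fin.rev - _ = _
    abel
  rw [h]
  simp [Matrix.mul_apply, PowerSeries.coeff_one, PowerSeries.coeff_succ_X_mul, unitMat]

theorem unitMat_mul_unitMat (N : ℕ) (i j k l : Fin N) :
    unitMat N i j * unitMat N k l = if i = l then unitMat N k j else 0 := by
  simp only [unitMat, Matrix.of_apply]
  split_ifs with h
  · rw [h, Matrix.single_mul_single_same, one_mul]
  · exact Matrix.single_mul_single_of_ne _ _ _ _ h _

theorem unitMat_flipTriple (N : ℕ) :
    FlipTriple (swapMat N (MvPowerSeries (Fin 2) (Matrix (Fin N) (Fin N) ℂ)))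
      (legHom₁ N _ ((unitMat N).map MvPowerSeries.C))
      (legHom₂ N _ ((unitMat N).map MvPowerSeries.C)) := by
  have hsq : (unitMat N).map (MvPowerSeries.C (σ := Fin 2)) *
      (unitMat N).map (MvPowerSeries.C (σ := Fin 2)) = 1 := by
    rw [← Matrix.map_mul]
    have : unitMat N * unitMat N = 1 := by
      ext1 i j
      rw [Matrix.mul_apply]
      simp only [unitMat_mul_unitMat]
      ext k l
      by_cases hij : i = j
      · simp [Matrix.sum_apply, hij, unitMat, Matrix.single_apply, Matrix.one_apply]
        rcases eq_or_ne k l with rfl | hkl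
        · simp [Finset.filter_eq']
        · rw [if_neg hkl, Finset.filter_false_of_mem (fun x _ hx => hkl (hx.1.symm.trans hx.2))]
          simp
      · simp [hij]
    rw [this]
    simp
  have hp : ∀ M : Matrix (Fin N) (Fin N) (MvPowerSeries (Fin 2) (Matrix (Fin N) (Fin N) ℂ)),
      swapMat N _ * legHom₁ N _ M = legHom₂ N _ M * swapMat N _ :=
    (quatFrame (m := 0) (Nat.zero_le N) (Matrix (Fin N) (Fin N) ℂ)).p_l₁
  have hp' : ∀ M : Matrix (Fin N) (Fin N) (MvPowerSeries (Fin 2) (Matrix (Fin N) (Fin N) ℂ)),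
      swapMat N _ * legHom₂ N _ M = legHom₁ N _ M * swapMat N _ :=
    (quatFrame (m := 0) (Nat.zero_le N) (Matrix (Fin N) (Fin N) ℂ)).p_l₂
  have hab : swapMat N _ * legHom₁ N _ ((unitMat N).map (MvPowerSeries.C (σ := Fin 2))) =
      legHom₁ N _ ((unitMat N).map MvPowerSeries.C) *
        legHom₂ N _ ((unitMat N).map MvPowerSeries.C) := by
    ext1 ⟨i, k⟩ ⟨j, l⟩
    rw [swapMat_mul, legHom₁_mul_legHom₂]
    simp only [Matrix.submatrix_apply, legHom₁_apply, Matrix.map_apply, ← map_mul,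
      unitMat_mul_unitMat, Prod.swap_prod_mk, id]
    split_ifs <;> simp
  have hba : swapMat N _ * legHom₂ N _ ((unitMat N).map (MvPowerSeries.C (σ := Fin 2))) =
      legHom₂ N _ ((unitMat N).map MvPowerSeries.C) *
        legHom₁ N _ ((unitMat N).map MvPowerSeries.C) := by
    ext1 ⟨i, k⟩ ⟨j, l⟩
    rw [swapMat_mul, legHom₂_mul_legHom₁]
    simp only [Matrix.submatrix_apply, legHom₂_apply, Matrix.map_apply, ← map_mul,
      unitMat_mul_unitMat, Prod.swap_prod_mk, id, eq_comm (a := k)]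
    split_ifs <;> simp
  refine ⟨?_, ?_, ?_, hab, (hp _).symm.trans hab, hba, (hp' _).symm.trans hba⟩
  · rw [swapMat_mul]
    ext1 a b
    simp [swapMat_apply, Matrix.one_apply]
  · rw [← map_mul, hsq, map_one]
  · rw [← map_mul, hsq, map_one]

theorem inVar_vectorS (N : ℕ) (v : Fin 2) :
    (inVarHom (Matrix (Fin N) (Fin N) ℂ) v).mapMatrix (vectorS N) =
      (1 - ((MvPowerSeries.X v : MvPowerSeries (Fin 2) (Matrix (Fin N) (Fin N) ℂ)) • 1) *
          (unitMat N).map MvPowerSeries.C) *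
        (antiDiag N _ *
          (1 - ((MvPowerSeries.X v : MvPowerSeries (Fin 2) (Matrix (Fin N) (Fin N) ℂ)) • 1) *
            (unitMat N).map MvPowerSeries.C) * antiDiag N _) := by
  have hC (M : Matrix (Fin N) (Fin N) ℂ) :
      inVarHom (Matrix (Fin N) (Fin N) ℂ) v (PowerSeries.C M) =
        MvPowerSeries.C (σ := Fin 2) M := by
    classical
    ext1 d
    rw [inVarHom_apply, coeff_inVar, PowerSeries.coeff_C, MvPowerSeries.coeff_C]
    by_cases h : d = 0
    · simp [h]
    · rw [if_neg h]
      split_ifs with h₁ h₂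
      · rw [h₂, Finsupp.single_zero] at h₁; exact absurd h₁ h
      · rfl
      · rfl
  have h : (inVarHom (Matrix (Fin N) (Fin N) ℂ) v).mapMatrix
      ((PowerSeries.X : PowerSeries (Matrix (Fin N) (Fin N) ℂ)) •
        (unitMat N).map PowerSeries.C) =
      ((MvPowerSeries.X v : MvPowerSeries (Fin 2) (Matrix (Fin N) (Fin N) ℂ)) • 1) *
        (unitMat N).map MvPowerSeries.C := by
    rw [smul_mul_assoc, one_mul]
    ext1 i j
    simp only [RingHom.mapMatrix_apply, Matrix.map_apply, Matrix.smul_apply, smul_eq_mul, map_mul,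
      hC]
    rw [inVarHom_apply, inVar_X]
  rw [vectorS, map_mul, map_mul, map_mul, map_sub, map_one, h, map_antiDiag]

theorem legHom₁_smul_one {N : ℕ} {W : Type*} [Ring W] (w : W) :
    legHom₁ N W (w • 1) = w • 1 := by
  ext1 a b
  by_cases h₁ : a.1 = b.1 <;> by_cases h₂ : a.2 = b.2 <;>
    simp [legHom₁_apply, Matrix.one_apply, Prod.ext_iff, h₁, h₂]

theorem legHom₂_smul_one {N : ℕ} {W : Type*} [Ring W] (w : W) :
    legHom₂ N W (w • 1) = w • 1 := by
  ext1 a b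
  by_cases h₁ : a.1 = b.1 <;> by_cases h₂ : a.2 = b.2 <;>
    simp [legHom₂_apply, Matrix.one_apply, Prod.ext_iff, h₁, h₂]

/-- The vector representation satisfies the quaternary relation. -/
theorem quatLHS_vectorS (N : ℕ) : quatLHS (vectorS N) = quatRHS (vectorS N) := by
  set W := MvPowerSeries (Fin 2) (Matrix (Fin N) (Fin N) ℂ)
  set F := quatFrame (m := 0) (Nat.zero_le N) (Matrix (Fin N) (Fin N) ℂ)
  have hX (v : Fin 2) (M : Matrix (Fin N × Fin N) (Fin N × Fin N) W) :
      Commute ((MvPowerSeries.X v : W) • (1 : Matrix (Fin N × Fin N) (Fin N × Fin N) W)) M :=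
    commute_smul_one (fun w => (MvPowerSeries.commute_X w v).symm) M
  have key := (unitMat_flipTriple N).reflection (hX 0) (hX 1)
    (g₁ := F.l₁ F.g) (g₂ := F.l₂ F.g)
    (by rw [← map_mul]; exact (congrArg _ antiDiag_mul_self).trans (map_one _))
    (by rw [← map_mul]; exact (congrArg _ antiDiag_mul_self).trans (map_one _))
    (F.g_comm _) (F.g_comm _) (F.g_comm' _) (F.p_l₁ _) (F.p_l₂ _)
  have hR : rMat N (Matrix (Fin N) (Fin N) ℂ) =
      (MvPowerSeries.X 1 : W) • 1 - (MvPowerSeries.X 0 : W) • 1 -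
        (MvPowerSeries.X 0 : W) • 1 * (MvPowerSeries.X 1 : W) • 1 * swapMat N W := by
    rw [rMat, smul_mul_assoc, one_mul, smul_smul, smul_mul_assoc, one_mul, sub_smul]
  have hR' : rMat' N (Matrix (Fin N) (Fin N) ℂ) =
      F.l₁ F.g * ((MvPowerSeries.X 1 : W) • 1 + (MvPowerSeries.X 0 : W) • 1 -
        (MvPowerSeries.X 0 : W) • 1 * (MvPowerSeries.X 1 : W) • 1 * swapMat N W) * F.l₁ F.g := by
    rw [smul_mul_assoc, one_mul, smul_smul, smul_mul_assoc, one_mul, ← add_smul]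
    rfl
  have h₁ : leg₁ (vectorS N) =
      (1 - (MvPowerSeries.X 0 : W) • 1 * legHom₁ N W ((unitMat N).map MvPowerSeries.C)) *
        (F.l₁ F.g *
          (1 - (MvPowerSeries.X 0 : W) • 1 * legHom₁ N W ((unitMat N).map MvPowerSeries.C)) *
          F.l₁ F.g) := by
    rw [leg₁_eq, inVar_vectorS]
    simp only [map_mul, map_sub, map_one, legHom₁_smul_one]
    rfl
  have h₂ : leg₂ (vectorS N) =
      (1 - (MvPowerSeries.X 1 : W) • 1 * legHom₂ N W ((unitMat N).map MvPowerSeries.C)) *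
        (F.l₂ F.g *
          (1 - (MvPowerSeries.X 1 : W) • 1 * legHom₂ N W ((unitMat N).map MvPowerSeries.C)) *
          F.l₂ F.g) := by
    rw [leg₂_eq, inVar_vectorS]
    simp only [map_mul, map_sub, map_one, legHom₂_smul_one]
    rfl
  rw [quatLHS, quatRHS, hR, hR', h₁, h₂]
  exact key

end Rep

/-! ### Shifts exist only for one rank -/

section Converse

theorem coeff_one_mul_mul {A : Type*} [Ring A] {f g k : PowerSeries A}
    (hf : PowerSeries.coeff 0 f = 0) (hk : PowerSeries.coeff 0 k = 0) :
    PowerSeries.coeff 1 (f * g * k) = 0 := by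
  simp [PowerSeries.coeff_mul, Finset.Nat.antidiagonal_succ, hf, hk]

/-- The series `s_{kl}(u)` with `k ≠ l` have no constant term, so that the correction in the
quasideterminant begins with `u⁻²`. -/
theorem coeff_one_quasidet {N M m : ℕ} (h : m + M ≤ N) (i : Fin M) :
    PowerSeries.coeff 1 (quasidet (borderBlock h i i)) =
      PowerSeries.coeff 1 (S N (shiftIdx h i) (shiftIdx h i)) := by
  have h₀ (a b : Fin N) (hab : a ≠ b) : PowerSeries.coeff 0 (S N a b) = 0 := by
    simp [S, serMatrix, hab]
  rw [quasidet, map_sub]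
  have : borderBlock h i i (Fin.last m) (Fin.last m) = S N (shiftIdx h i) (shiftIdx h i) := by
    simp [borderBlock, borderIdx]
  rw [this, sub_eq_self, map_sum]
  refine Finset.sum_eq_zero fun k _ => ?_
  rw [map_sum]
  refine Finset.sum_eq_zero fun l _ => coeff_one_mul_mul ?_ ?_
  · simp only [borderBlock, borderIdx, Matrix.submatrix_apply, Fin.snoc_last, Fin.snoc_castSucc]
    apply h₀
    simp [shiftIdx, Fin.ext_iff]
    omega
  · simp only [borderBlock, borderIdx, Matrix.submatrix_apply, Fin.snoc_last, Fin.snoc_castSucc]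
    apply h₀
    simp [shiftIdx, Fin.ext_iff]
    omega

/-- In rank `M` the coefficients of `u⁻¹` in `s_{11}(u)` and `s_{MM}(u)` agree, and in the vector
representation of rank `N` this forces the indices `m + 1` and `m + M` to be exchanged by
`i ↦ N + 1 - i`. -/
theorem eq_add_two_mul_of_isShiftHom {N M m : ℕ} (h : m + M ≤ N) (hM : 2 ≤ M)
    {φ : ExtTwistedYangian M →ₐ[ℂ] ExtTwistedYangian N} (hφ : IsShiftHom h φ) :
    N = M + 2 * m := by
  obtain ⟨ρ, hρ⟩ := exists_algHom_of_quat (constantCoeff_vectorS N) (quatLHS_vectorS N)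
  have key (i : Fin M) : ρ (φ (PowerSeries.coeff 1 (S M i i))) =
      -(Matrix.single (shiftIdx h i) (shiftIdx h i) 1 +
        Matrix.single (shiftIdx h i).rev (shiftIdx h i).rev 1) := by
    have h₁ := congrArg (PowerSeries.coeff 1) (hφ i i)
    rw [PowerSeries.coeff_map, coeff_one_quasidet] at h₁
    have h₂ := congrArg (PowerSeries.coeff 1) (hρ (shiftIdx h i) (shiftIdx h i))
    rw [PowerSeries.coeff_map, coeff_one_vectorS] at h₂
    rw [← h₂, ← h₁]
    rfl
  let i : Fin M := ⟨0, by omega⟩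
  have hi := key i
  have hS : (PowerSeries.constantCoeff (R := ExtTwistedYangian M)).mapMatrix (S M) = 1 :=
    constantCoeff_serMatrix _
  rw [coeff_one_rev_eq hS (quatLHS_S M), key, neg_inj] at hi
  have hii := congrFun (congrFun hi (shiftIdx h i)) (shiftIdx h i)
  have hne : shiftIdx h i.rev ≠ shiftIdx h i := by
    simp [shiftIdx, i]; omega
  by_contra hN
  have hne' : (shiftIdx h i.rev).rev ≠ shiftIdx h i := by
    simp [shiftIdx, i, Fin.ext_iff]; omega
  simp only [Matrix.add_apply, Matrix.single_apply, hne, hne', and_self, if_true, if_false,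
    add_zero] at hii
  split_ifs at hii <;> norm_num at hii

end Converse

end

end TwistedYangian

theorem mainTheorem9 (N : ℕ) :
    -- existence (and uniqueness) of the shift homomorphisms `X_{N-2m} → X_N`
    (∀ (m : ℕ) (hm : 2 * m + 1 ≤ N),
      (∀ i j : Fin (N - 2 * m), IsUnit
        (TwistedYangian.leadingMinor
          (TwistedYangian.borderBlock (TwistedYangian.shift_le hm) i j))) ∧
      ∃! ψ : TwistedYangian.ExtTwistedYangian (N - 2 * m) →ₐ[ℂ]
          TwistedYangian.ExtTwistedYangian N,
        TwistedYangian.IsShiftHom (TwistedYangian.shift_le hm) ψ) ∧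
    -- a shift `X_M → X_N` by `m`, with `M ≥ 2`, is a homomorphism only if `M = N - 2m`
    (∀ (M m : ℕ) (h : m + M ≤ N), 2 ≤ M →
      (∃ φ : TwistedYangian.ExtTwistedYangian M →ₐ[ℂ] TwistedYangian.ExtTwistedYangian N,
        TwistedYangian.IsShiftHom h φ) →
      N = M + 2 * m) :=
  ⟨fun _ hm => TwistedYangian.existsUnique_isShiftHom hm,
    fun _ _ h hM ⟨_, hφ⟩ => TwistedYangian.eq_add_two_mul_of_isShiftHom h hM hφ⟩
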